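/- **Conventions.** Let $P$ be a smooth manifold (finite-dimensional, Hausdorff, without boundary) and let $A\to P$ be a smooth real vector bundle of finite rank with dual bundle $A^*$ and pairing $\langle\xi,X\rangle$ for $\xi\in\Gamma(A^*)$, $X\in\Gamma(A)$. A *Lie algebroid* structure on a vector bundle $V\to P$ consists of an $\mathbb R$-Lie bracket $[\cdot,\cdot]$ on $\Gamma(V)$ and a bundle map $a:V\to TP$ (the anchor) with $a[X,Y]=[aX,aY]$ and $[X,fY]=f[X,Y]+(a(X)f)Y$ for all $X,Y\in\Gamma(V)$, $f\in C^\infty(P)$. It determines the differential $d:\Gamma(\wedge^kV^*)\to\Gamma(\wedge^{k+1}V^*)$, $$(d\omega)(X_0,\dots,X_k)=\sum_i(-1)^i a(X_i)\,\omega(\dots,\widehat{X_i},\dots)+\sum_{i<j}(-1)^{i+j}\omega([X_i,X_j],\dots,\widehat{X_i},\dots,\widehat{X_j},\dots),$$ so that $\langle df,X\rangle=a(X)f$ on functions; the Lie derivative $L_X\xi\in\Gamma(V^*)$ of $\xi\in\Gamma(V^*)$, $\langle L_X\xi,Y\rangle=a(X)\langle\xi,Y\rangle-\langle\xi,[X,Y]\rangle$;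 and the Schouten bracket $\Gamma(\wedge^pV)\times\Gamma(\wedge^qV)\to\Gamma(\wedge^{p+q-1}V)$, the biadditive extension of the bracket of sections with $$[X_1\wedge\dots\wedge X_p,\,Y_1\wedge\dots\wedge Y_q]=\sum_{i,j}(-1)^{i+j}[X_i,Y_j]\wedge X_1\wedge\dots\widehat{X_i}\dots\wedge X_p\wedge Y_1\wedge\dots\widehat{Y_j}\dots\wedge Y_q ,$$ $[Q,f]=(-1)^{p-1}\,Q(df,\cdot)$ and $[f,Q]=-Q(df,\cdot)$ for $Q\in\Gamma(\wedge^pV)$, $p\ge1$, and $[f,g]=0$, for $f,g\in C^\infty(P)$. Suppose that both $A$ and $A^*$ carry Lie algebroid structures, with anchors $a$ and $a_*$; write $d,L_X$ for the operators determined by $A$, and $d_*,L_\xi$ for those determined by $A^*$ (acting on $\Gamma(\wedge^\bullet A)$). The pair $(A,A^*)$ is a *Lie bialgebroid* if $d_*$ is a derivation of the Schouten bracket of $A$: $$d_*[Q,R]=[d_*Q,R]+(-1)^{p-1}[Q,d_*R]\qquad\text{for all }p,q\ge 0,\ Q\in\Gamma(\wedge^pA),\ R\in\Gamma(\wedge^qA).$$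 A *Courant algebroid* is a smooth vector bundle $E\to P$ with a smooth nondegenerate symmetric bilinear form $(\cdot,\cdot)$ on its fibres, a skew-symmetric $\mathbb R$-bilinear bracket $[\cdot,\cdot]$ on $\Gamma(E)$ and a bundle map $\rho:E\to TP$ such that, where $\mathcal D:C^\infty(P)\to\Gamma(E)$ is defined by $(\mathcal Df,e)=\tfrac12\rho(e)f$ and $T(e_1,e_2,e_3)=\tfrac13([e_1,e_2],e_3)+\text{c.p.}$ (c.p. denotes the cyclic permutations), for all $e,e_i,h_i\in\Gamma(E)$ and $f,g\in C^\infty(P)$: 1. $[[e_1,e_2],e_3]+\text{c.p.}=\mathcal D\,T(e_1,e_2,e_3)$; 2. $\rho[e_1,e_2]=[\rho e_1,\rho e_2]$; 3. $[e_1,fe_2]=f[e_1,e_2]+(\rho(e_1)f)e_2-(e_1,e_2)\mathcal Df$; 4. $\rho\circ\mathcal D=0$, i.e. $(\mathcal Df,\mathcal Dg)=0$; 5. $\rho(e)(h_1,h_2)=([e,h_1]+\mathcal D(e,h_1),h_2)+(h_1,[e,h_2]+\mathcal D(e,h_2))$. **Theorem.** Let $(A,A^*)$ be a Lie bialgebroid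 over $P$, and let $E=A\oplus A^*$. Put $$(X_1+\xi_1,X_2+\xi_2)_\pm=\tfrac12\big(\langle\xi_1,X_2\rangle\pm\langle\xi_2,X_1\rangle\big),\qquad \rho(X+\xi)=a(X)+a_*(\xi),$$ and, for $e_1=X_1+\xi_1$, $e_2=X_2+\xi_2\in\Gamma(E)$, $$[e_1,e_2]=\big([X_1,X_2]+L_{\xi_1}X_2-L_{\xi_2}X_1-d_*(e_1,e_2)_-\big)+\big([\xi_1,\xi_2]+L_{X_1}\xi_2-L_{X_2}\xi_1+d(e_1,e_2)_-\big).$$ Then $E$ with the bracket $[\cdot,\cdot]$, the bundle map $\rho$ and the form $(\cdot,\cdot)_+$ is a Courant algebroid. -/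

import Mathlib

set_option linter.unusedSectionVars false

noncomputable section

namespace Algebroid

section Koszul

variable {R M : Type*} [CommRing R] [AddCommGroup M] [Module R M]

/-- Koszul's formula for the differential of an alternating form, for a bracket `br` and an action
`a` on functions:
`∑ᵢ (-1)ⁱ a(Xᵢ) ω(X₀, …, X̂ᵢ, …, X_k) + ∑_{i<j} (-1)^{i+j} ω([Xᵢ, Xⱼ], X₀, …, X̂ᵢ, …, X̂ⱼ, …, X_k)`.
In the second sum `[Xᵢ, Xⱼ]` is written in the place of `Xⱼ` instead of in front, which changes the
sign from `(-1)^{i+j}` to `-(-1)ⁱ`. -/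
def koszul (a : M → R → R) (br : M → M → M) {k : ℕ} (ω : M [⋀^Fin k]→ₗ[R] R)
    (X : Fin (k + 1) → M) : R :=
  ∑ i : Fin (k + 1), (-1 : ℤ) ^ (i : ℕ) • (a (X i) (ω (i.removeNth X))
    - ∑ j ∈ Finset.univ.filter (fun j => i < j),
        ω (i.removeNth (Function.update X j (br (X i) (X j)))))

/-- The algebraic part of the axioms of a bracket and its action on functions. -/
structure IsDerivationPair (a : M → R → R) (br : M → M → M) : Prop where
  act_add_left : ∀ x y f, a (x + y) f = a x f + a y f
  act_smul_left : ∀ g x f, a (g • x) f = g * a x f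
  act_add : ∀ x f g, a x (f + g) = a x f + a x g
  act_mul : ∀ x f g, a x (f * g) = f * a x g + a x f * g
  add_br : ∀ x y z, br (x + y) z = br x z + br y z
  br_skew : ∀ x y, br x y = -br y x
  br_smul : ∀ x f y, br x (f • y) = f • br x y + a x f • y
  two_torsion : ∀ f : R, f + f = 0 → f = 0

namespace IsDerivationPair

variable {a : M → R → R} {br : M → M → M}

theorem br_add (h : IsDerivationPair a br) (x y z : M) : br x (y + z) = br x y + br x z := by
  rw [h.br_skew, h.add_br, neg_add, ← h.br_skew, ← h.br_skew]

theorem smul_br (h : IsDerivationPair a br) (f : R) (x y : M) : br (f • x) y = f • br x y - a y f • x := by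
  rw [h.br_skew, h.br_smul, neg_add, ← smul_neg, ← h.br_skew, sub_eq_add_neg]

/-- `f ↦ a(x) f` as an additive map. -/
def aHom (h : IsDerivationPair a br) (x : M) : R →+ R := AddMonoidHom.mk' (a x) (h.act_add x)

/-- `y ↦ [x, y]` as an additive map. -/
def brHom (h : IsDerivationPair a br) (x : M) : M →+ M := AddMonoidHom.mk' (br x) (h.br_add x)

/-- An auxiliary form. -/
def half (h : IsDerivationPair a br) {k : ℕ} (ω : M [⋀^Fin k]→ₗ[R] R) (x : M) : M [⋀^Fin k]→ₗ[ℤ] R where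
  toFun Y := (2 : ℤ) • a x (ω Y) - ∑ j, ω (Function.update Y j (br x (Y j)))
  map_update_add' := by
    intro inst Y p y z
    have e : inst = instDecidableEqFin k := Subsingleton.elim _ _
    subst e
    have key : ∀ y : M, ∑ j, ω (Function.update (Function.update Y p y) j
        (br x (Function.update Y p y j))) = ω (Function.update Y p (br x y))
        + ∑ j ∈ Finset.univ.erase p,
          ω (Function.update (Function.update Y j (br x (Y j))) p y) := by
      intro y
      rw [← Finset.add_sum_erase _ _ (Finset.mem_univ p)]
      congr 1
      · simp
      · refine Finset.sum_congr rfl fun j hj => ?_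
        have hjp : j ≠ p := Finset.ne_of_mem_erase hj
        rw [Function.update_of_ne hjp, Function.update_comm hjp]
    rw [key, key, key]
    simp only [AlternatingMap.map_update_add, h.act_add, h.br_add, Finset.sum_add_distrib,
      smul_add]
    abel
  map_update_smul' := by
    intro inst Y p c y
    have e : inst = instDecidableEqFin k := Subsingleton.elim _ _
    subst e
    have key : ∀ y : M, ∑ j, ω (Function.update (Function.update Y p y) j
        (br x (Function.update Y p y j))) = ω (Function.update Y p (br x y))
        + ∑ j ∈ Finset.univ.erase p,
          ω (Function.update (Function.update Y j (br x (Y j))) p y) := by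
      intro y
      rw [← Finset.add_sum_erase _ _ (Finset.mem_univ p)]
      congr 1
      · simp
      · refine Finset.sum_congr rfl fun j hj => ?_
        have hjp : j ≠ p := Finset.ne_of_mem_erase hj
        rw [Function.update_of_ne hjp, Function.update_comm hjp]
    have hz : ∀ (Z : Fin k → M) (c : ℤ) (y : M), ω (Function.update Z p (c • y))
        = c • ω (Function.update Z p y) := fun Z c y =>
      map_zsmul (AddMonoidHom.mk' (fun y => ω (Function.update Z p y))
        (fun y z => ω.map_update_add Z p y z)) c y
    have h1 : br x (c • y) = c • br x y := map_zsmul (h.brHom x) c y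
    have h2 : ∀ f, a x (c • f) = c • a x f := fun f => map_zsmul (h.aHom x) c f
    rw [key, key, h1]
    simp only [hz, h2, ← Finset.smul_sum, smul_sub, smul_add]
    rw [smul_comm]
  map_eq_zero_of_eq' := by
    intro Y p q hpq hne
    have h0 : a x 0 = 0 := map_zero (h.aHom x)
    rw [ω.map_eq_zero_of_eq Y hpq hne, h0, smul_zero, zero_sub, neg_eq_zero]
    rw [Fintype.sum_eq_add p q hne]
    · have hsw : Function.update Y q (br x (Y q))
          = Function.update Y p (br x (Y p)) ∘ Equiv.swap p q := by
        ext j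
        rcases eq_or_ne j p with rfl | hjp
        · simp [Function.update_of_ne hne, Function.update_of_ne hne.symm, hpq]
        rcases eq_or_ne j q with rfl | hjq
        · simp [hpq]
        · simp [Equiv.swap_apply_of_ne_of_ne hjp hjq, Function.update_of_ne hjp,
            Function.update_of_ne hjq]
      rw [hsw, ω.map_swap _ hne, add_neg_cancel]
    · rintro j ⟨hjp, hjq⟩
      exact ω.map_eq_zero_of_eq _ (by simp [Function.update_of_ne, Ne.symm hjp, Ne.symm hjq, hpq]) hne

theorem half_apply (h : IsDerivationPair a br) {k : ℕ} (ω : M [⋀^Fin k]→ₗ[R] R) (x : M)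
    (Y : Fin k → M) : h.half ω x Y
      = (2 : ℤ) • a x (ω Y) - ∑ j, ω (Function.update Y j (br x (Y j))) := rfl

/-- An auxiliary form. -/
def halfHom (h : IsDerivationPair a br) {k : ℕ} (ω : M [⋀^Fin k]→ₗ[R] R) :
    M →ₗ[ℤ] M [⋀^Fin k]→ₗ[ℤ] R :=
  (AddMonoidHom.mk' (h.half ω) (fun x y => by
    ext Y
    rw [AlternatingMap.add_apply]
    simp only [half_apply, h.act_add_left, h.add_br, ω.map_update_add, Finset.sum_add_distrib,
      smul_add]
    abel)).toIntLinearMap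

theorem halfHom_apply (h : IsDerivationPair a br) {k : ℕ} (ω : M [⋀^Fin k]→ₗ[R] R) (x : M)
    (Y : Fin k → M) : h.halfHom ω x Y
      = (2 : ℤ) • a x (ω Y) - ∑ j, ω (Function.update Y j (br x (Y j))) := rfl

/-- Twice Koszul's expression is an alternatization. -/
theorem koszul_add_self (h : IsDerivationPair a br) {k : ℕ} (ω : M [⋀^Fin k]→ₗ[R] R)
    (X : Fin (k + 1) → M) : koszul a br ω X + koszul a br ω X
      = AlternatingMap.alternatizeUncurryFin (h.halfHom ω) X := by
  let t : Fin (k + 1) → Fin (k + 1) → R := fun i j =>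
    (-1 : ℤ) ^ (i : ℕ) • ω (i.removeNth (Function.update X j (br (X i) (X j))))
  have ht : ∀ i j, i ≠ j → t i j = t j i := by
    intro i j hij
    let v := Function.update (Function.update X i (br (X i) (X j))) j (br (X i) (X j))
    have h1 := ω.neg_one_pow_smul_map_removeNth_add_eq_zero_of_eq (v := v) (i := i) (j := j)
      (by simp [v, Function.update_of_ne hij]) hij
    have h2 : i.removeNth v = i.removeNth (Function.update X j (br (X i) (X j))) := by
      simp only [v]
      rw [Function.update_comm hij, Fin.removeNth_update]
    have h3 : j.removeNth v = j.removeNth (Function.update X i (br (X i) (X j))) := by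
      simp only [v]
      rw [Fin.removeNth_update]
    have h4 : ω (j.removeNth (Function.update X i (br (X j) (X i))))
        = - ω (j.removeNth (Function.update X i (br (X i) (X j)))) := by
      obtain ⟨i', rfl⟩ := Fin.exists_succAbove_eq hij
      rw [Fin.removeNth_update_succAbove, Fin.removeNth_update_succAbove, h.br_skew, ω.map_update_neg]
    simp only [t]
    rw [h4, smul_neg, eq_neg_iff_add_eq_zero, ← h2, ← h3]
    exact h1
  have hk : koszul a br ω X = ∑ i : Fin (k + 1), (-1 : ℤ) ^ (i : ℕ) • a (X i) (ω (i.removeNth X))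
      - ∑ i, ∑ j, if i < j then t i j else 0 := by
    rw [← Finset.sum_sub_distrib]
    refine Finset.sum_congr rfl fun i _ => ?_
    rw [smul_sub, Finset.smul_sum, Finset.sum_filter]
  have hk' : koszul a br ω X = ∑ i : Fin (k + 1), (-1 : ℤ) ^ (i : ℕ) • a (X i) (ω (i.removeNth X))
      - ∑ i, ∑ j, if j < i then t i j else 0 := by
    rw [hk, Finset.sum_comm]
    congr 1
    refine Finset.sum_congr rfl fun i _ => Finset.sum_congr rfl fun j _ => ?_
    split_ifs with hij
    · exact ht j i hij.ne
    · rfl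
  conv_lhs => congr; rw [hk]
  rw [hk', AlternatingMap.alternatizeUncurryFin_apply]
  have h5 : ∀ i : Fin (k + 1), (-1 : ℤ) ^ (i : ℕ) • h.halfHom ω (X i) (i.removeNth X)
      = (-1 : ℤ) ^ (i : ℕ) • a (X i) (ω (i.removeNth X))
       + (-1 : ℤ) ^ (i : ℕ) • a (X i) (ω (i.removeNth X))
       - ((∑ j, if i < j then t i j else 0) + ∑ j, if j < i then t i j else 0) := by
    intro i
    rw [halfHom_apply, smul_sub, smul_smul, mul_comm, mul_smul, two_smul, ← Finset.sum_add_distrib,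
      Fin.sum_univ_succAbove _ i]
    congr 1
    simp only [lt_irrefl, if_false, add_zero, zero_add]
    rw [Finset.smul_sum]
    refine Finset.sum_congr rfl fun j _ => ?_
    have h6 : ω (Function.update (i.removeNth X) j (br (X i) (i.removeNth X j)))
        = ω (i.removeNth (Function.update X (i.succAbove j) (br (X i) (X (i.succAbove j))))) := by
      rw [Fin.removeNth_update_succAbove]; rfl
    rcases lt_or_gt_of_ne (Fin.succAbove_ne i j) with hlt | hgt
    · simp only [hlt, hlt.not_gt, if_true, if_false, zero_add, t, h6]
    · simp only [hgt, hgt.not_gt, if_true, if_false, add_zero, t, h6]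
  simp only [h5, Finset.sum_add_distrib, Finset.sum_sub_distrib]
  abel

theorem eq_of_add_self (h : IsDerivationPair a br) {f g : R} (e : f + f = g + g) : f = g := by
  rw [← sub_eq_zero]
  apply h.two_torsion
  linear_combination e

theorem koszul_smul (h : IsDerivationPair a br) {k : ℕ} (ω : M [⋀^Fin k]→ₗ[R] R)
    (X : Fin (k + 1) → M) (m : Fin (k + 1)) (f : R) :
    koszul a br ω (Function.update X m (f • X m)) = f * koszul a br ω X := by
  apply h.eq_of_add_self
  rw [← mul_add, h.koszul_add_self, h.koszul_add_self, AlternatingMap.alternatizeUncurryFin_apply,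
    AlternatingMap.alternatizeUncurryFin_apply, Fin.sum_univ_succAbove _ m,
    Fin.sum_univ_succAbove (fun i => (-1 : ℤ) ^ (i : ℕ) • h.halfHom ω (X i) (i.removeNth X)) m]
  have h1 : h.halfHom ω (f • X m) (m.removeNth X) = f * h.halfHom ω (X m) (m.removeNth X)
      + ∑ j, a (X (m.succAbove j)) f * ω (Function.update (m.removeNth X) j (X m)) := by
    rw [halfHom_apply, halfHom_apply, h.act_smul_left]
    have : ∀ j, ω (Function.update (m.removeNth X) j (br (f • X m) (m.removeNth X j)))
        = f * ω (Function.update (m.removeNth X) j (br (X m) (m.removeNth X j)))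
          - a (X (m.succAbove j)) f * ω (Function.update (m.removeNth X) j (X m)) := by
      intro j
      rw [h.smul_br, ω.map_update_sub, ω.map_update_smul, ω.map_update_smul]; rfl
    simp only [this, Finset.sum_sub_distrib, ← Finset.mul_sum]
    simp only [zsmul_eq_mul]
    ring
  have h2 : ∀ j : Fin k, h.halfHom ω (X (m.succAbove j))
        ((m.succAbove j).removeNth (Function.update X m (f • X m)))
      = f * h.halfHom ω (X (m.succAbove j)) ((m.succAbove j).removeNth X)
        + a (X (m.succAbove j)) f * ω ((m.succAbove j).removeNth X) := by
    intro j
    obtain ⟨m', hm'⟩ := Fin.exists_succAbove_eq (Fin.succAbove_ne m j).symm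
    have hu : (m.succAbove j).removeNth (Function.update X m (f • X m))
        = Function.update ((m.succAbove j).removeNth X) m' (f • X m) := by
      have := Fin.removeNth_update_succAbove (α := fun _ => M) (m.succAbove j) m' (f • X m) X
      rwa [hm'] at this
    have hX : (m.succAbove j).removeNth X m' = X m := congrArg X hm'
    rw [hu]
    generalize hY : (m.succAbove j).removeNth X = Y at *
    generalize X (m.succAbove j) = x at *
    rw [← hX]
    rw [halfHom_apply, halfHom_apply, ω.map_update_smul, Function.update_eq_self, smul_eq_mul,
      h.act_mul]
    have h3 : ∑ i, ω (Function.update (Function.update Y m' (f • Y m')) i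
          (br x (Function.update Y m' (f • Y m') i)))
        = f * ∑ i, ω (Function.update Y i (br x (Y i))) + a x f * ω Y := by
      rw [← Finset.add_sum_erase _ _ (Finset.mem_univ m'),
        ← Finset.add_sum_erase Finset.univ (fun i => ω (Function.update Y i (br x (Y i))))
          (Finset.mem_univ m')]
      have h4 : ∀ i ∈ Finset.univ.erase m', ω (Function.update (Function.update Y m' (f • Y m')) i
          (br x (Function.update Y m' (f • Y m') i)))
          = f * ω (Function.update Y i (br x (Y i))) := by
        intro i hi
        have hi' := Finset.ne_of_mem_erase hi
        rw [Function.update_of_ne hi', Function.update_comm hi'.symm, ω.map_update_smul]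
        congr 2
        rw [Function.update_eq_self_iff, Function.update_of_ne hi'.symm]
      rw [Finset.sum_congr rfl h4, ← Finset.mul_sum]
      simp only [Function.update_self, Function.update_idem]
      rw [h.br_smul, ω.map_update_add, ω.map_update_smul, ω.map_update_smul,
        Function.update_eq_self]
      simp only [smul_eq_mul]
      ring
    rw [h3]
    simp only [zsmul_eq_mul]
    push_cast
    ring
  have h3 : ∀ j : Fin k, (-1 : ℤ) ^ (m : ℕ) • ω (Function.update (m.removeNth X) j (X m))
      + (-1 : ℤ) ^ (m.succAbove j : ℕ) • ω ((m.succAbove j).removeNth X) = 0 := by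
    intro j
    have h4 := ω.neg_one_pow_smul_map_removeNth_add_eq_zero_of_eq
      (v := Function.update X (m.succAbove j) (X m)) (i := m) (j := m.succAbove j)
      (by simp) (Fin.succAbove_ne m j).symm
    rwa [Fin.removeNth_update_succAbove, Fin.removeNth_update] at h4
  simp only [Function.update_self, Fin.removeNth_update, h1,
    Function.update_of_ne (Fin.succAbove_ne m _), h2]
  have h4 : ∀ j : Fin k, (-1 : ℤ) ^ (m : ℕ) • (a (X (m.succAbove j)) f *
        ω (Function.update (m.removeNth X) j (X m)))
      + (-1 : ℤ) ^ (m.succAbove j : ℕ) • (a (X (m.succAbove j)) f *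
        ω ((m.succAbove j).removeNth X)) = 0 := by
    intro j
    rw [← mul_smul_comm, ← mul_smul_comm, ← mul_add, h3, mul_zero]
  have h5 := Finset.sum_eq_zero (s := Finset.univ) fun j (_ : j ∈ Finset.univ) => h4 j
  rw [Finset.sum_add_distrib, ← Finset.smul_sum] at h5
  simp only [smul_add, Finset.sum_add_distrib, mul_add, Finset.mul_sum, mul_smul_comm] at h5 ⊢
  linear_combination h5

/-- Koszul's expression is an alternating form. -/
def koszulForm (h : IsDerivationPair a br) {k : ℕ} (ω : M [⋀^Fin k]→ₗ[R] R) :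
    M [⋀^Fin (k + 1)]→ₗ[R] R where
  toFun := koszul a br ω
  map_update_add' := by
    intro inst X m x y
    have e : inst = instDecidableEqFin (k + 1) := Subsingleton.elim _ _
    subst e
    apply h.eq_of_add_self
    rw [h.koszul_add_self, AlternatingMap.map_update_add, ← h.koszul_add_self,
      ← h.koszul_add_self]
    abel
  map_update_smul' := by
    intro inst X m f x
    have e : inst = instDecidableEqFin (k + 1) := Subsingleton.elim _ _
    subst e
    have := h.koszul_smul ω (Function.update X m x) m f
    simpa using this
  map_eq_zero_of_eq' := by
    intro X i j hX hij
    apply h.two_torsion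
    rw [h.koszul_add_self, AlternatingMap.map_eq_zero_of_eq _ X hX hij]

end IsDerivationPair
end Koszul

section AltSum

variable {R M : Type*} [CommRing R] [Algebra ℝ R] [AddCommGroup M] [Module R M] {n : ℕ}

theorem altSum_eq_zero (H : (Fin n → M) → R) (u : Fin n → ℝ) (k₀ : Fin n)
    (hH : ∀ k, k ≠ k₀ → u k ≠ 0 → ∀ ζ, H (ζ ∘ Equiv.swap k₀ k) = -H ζ) (hu : ∑ k, u k = 0)
    (m : Fin n) (ξ : Fin n → M) :
    ∑ σ : Equiv.Perm (Fin n), (Equiv.Perm.sign σ : ℤ) • (u (σ.symm m) • H (ξ ∘ σ)) = 0 := by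
  let S : Fin n → R := fun k => ∑ σ : Equiv.Perm (Fin n),
    if σ.symm m = k then (Equiv.Perm.sign σ : ℤ) • H (ξ ∘ σ) else 0
  have hS : ∀ k, k ≠ k₀ → u k ≠ 0 → S k = S k₀ := by
    intro k hk huk
    simp only [S]
    rw [← Equiv.sum_comp (Equiv.mulRight (Equiv.swap k₀ k))]
    refine Finset.sum_congr rfl fun σ _ => ?_
    have h1 : ((Equiv.mulRight (Equiv.swap k₀ k)) σ).symm m = k ↔ σ.symm m = k₀ := by
      simp only [Equiv.coe_mulRight, Equiv.symm_apply_eq, Equiv.Perm.mul_apply,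
        Equiv.swap_apply_right]
    have h2 : H (ξ ∘ ⇑((Equiv.mulRight (Equiv.swap k₀ k)) σ)) = -H (ξ ∘ σ) :=
      hH k hk huk (ξ ∘ σ)
    have h3 : (Equiv.Perm.sign ((Equiv.mulRight (Equiv.swap k₀ k)) σ) : ℤ)
        = -(Equiv.Perm.sign σ : ℤ) := by
      simp [Equiv.Perm.sign_mul, Equiv.Perm.sign_swap hk.symm]
    simp only [h1, h2, h3, smul_neg, neg_smul, neg_neg]
  have h4 : ∑ σ : Equiv.Perm (Fin n), (Equiv.Perm.sign σ : ℤ) • (u (σ.symm m) • H (ξ ∘ σ))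
      = ∑ k, u k • S k := by
    simp only [S, Finset.smul_sum]
    rw [Finset.sum_comm]
    refine Finset.sum_congr rfl fun σ _ => ?_
    rw [Finset.sum_eq_single (σ.symm m)]
    · rw [if_pos rfl, smul_comm]
    · intro k _ hk
      rw [if_neg hk.symm, smul_zero]
    · simp
  rw [h4]
  have h5 : ∀ k, u k • S k = u k • S k₀ := by
    intro k
    by_cases hk : k = k₀
    · rw [hk]
    · by_cases huk : u k = 0
      · rw [huk, zero_smul, zero_smul]
      · rw [hS k hk huk]
  rw [Finset.sum_congr rfl fun k _ => h5 k, ← Finset.sum_smul, hu, zero_smul]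

/-- Antisymmetrization of an additive expression whose failure to be linear over `R` cancels. -/
def altSumForm (G : (Fin n → M) → R)
    (hadd : ∀ ζ k x y, G (Function.update ζ k (x + y))
      = G (Function.update ζ k x) + G (Function.update ζ k y))
    (hsmul : ∀ f m ξ, ∑ σ : Equiv.Perm (Fin n), (Equiv.Perm.sign σ : ℤ) •
      (G (Function.update (ξ ∘ σ) (σ.symm m) (f • ξ m)) - f * G (ξ ∘ σ)) = 0) :
    M [⋀^Fin n]→ₗ[R] R where
  toFun ξ := ∑ σ : Equiv.Perm (Fin n), (Equiv.Perm.sign σ : ℤ) • G (ξ ∘ σ)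
  map_update_add' := by
    intro inst ξ m x y
    have e : inst = instDecidableEqFin n := Subsingleton.elim _ _
    subst e
    rw [← Finset.sum_add_distrib]
    refine Finset.sum_congr rfl fun σ _ => ?_
    have key : ∀ z, Function.update ξ m z ∘ σ = Function.update (ξ ∘ σ) (σ.symm m) z :=
      fun z => Function.update_comp_equiv ξ σ m z
    rw [key, key, key, hadd, smul_add]
  map_update_smul' := by
    intro inst ξ m f x
    have e : inst = instDecidableEqFin n := Subsingleton.elim _ _
    subst e
    have key : ∀ (ξ : Fin n → M) (σ : Equiv.Perm (Fin n)) z,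
        Function.update ξ m z ∘ σ = Function.update (ξ ∘ σ) (σ.symm m) z :=
      fun ξ σ z => Function.update_comp_equiv ξ σ m z
    have h := hsmul f m (Function.update ξ m x)
    simp only [smul_sub, Finset.sum_sub_distrib, sub_eq_zero] at h
    rw [smul_eq_mul, Finset.mul_sum]
    simp only [mul_smul_comm, ← key, Function.update_idem, Function.update_self] at h ⊢
    exact h
  map_eq_zero_of_eq' := by
    intro ξ i j hij hne
    refine Finset.sum_involution (fun σ _ => Equiv.swap i j * σ) ?_ ?_ ?_ ?_
    · intro σ _
      have h1 : ξ ∘ ⇑(Equiv.swap i j * σ) = ξ ∘ σ := by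
        ext k
        simp only [Function.comp_apply, Equiv.Perm.mul_apply]
        exact congrFun (show ξ ∘ Equiv.swap i j = ξ from by
          ext l
          rcases eq_or_ne l i with rfl | hl
          · simp [hij]
          rcases eq_or_ne l j with rfl | hl'
          · simp [hij]
          · simp [Equiv.swap_apply_of_ne_of_ne hl hl']) (σ k)
      rw [h1]
      simp [Equiv.Perm.sign_mul, Equiv.Perm.sign_swap hne]
    · intro σ _ _ h
      have := mul_eq_right.1 h
      exact hne (Equiv.swap_eq_one_iff.1 this)
    · intro σ _; exact Finset.mem_univ _
    · intro σ _; simp [← mul_assoc]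

end AltSum

end Algebroid
end

open Bundle
open scoped Manifold ContDiff Topology Bundle

noncomputable section

namespace Algebroid

section Geometry

variable {EP : Type*} [NormedAddCommGroup EP] [NormedSpace ℝ EP]
  {HP : Type*} [TopologicalSpace HP] {I : ModelWithCorners ℝ EP HP}
  {P : Type*} [TopologicalSpace P] [ChartedSpace HP P]
  {F : Type*} [NormedAddCommGroup F] [NormedSpace ℝ F]
  {V : P → Type*} [∀ x, AddCommGroup (V x)] [∀ x, Module ℝ (V x)] [∀ x, TopologicalSpace (V x)]
  [TopologicalSpace (TotalSpace F V)] [FiberBundle F V]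

/-- The dual bundle `V*`, with fibre `(V x)*` over `x`; its model fibre is `F →L[ℝ] ℝ`. -/
abbrev Dual (V : P → Type*) [∀ x, AddCommGroup (V x)] [∀ x, Module ℝ (V x)]
    [∀ x, TopologicalSpace (V x)] : P → Type _ :=
  fun x => V x →L[ℝ] Bundle.Trivial P ℝ x

variable (I F V) in
/-- `Γ(V)`: smooth sections. -/
abbrev Sec := ContMDiffSection I F ∞ V

variable (I P) in
/-- `C^∞(P)`. -/
abbrev Fn := ContMDiffMap I 𝓘(ℝ, ℝ) P ℝ ∞

/-- `Γ(V)` is a module over `C^∞(P)`, with pointwise multiplication. -/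
instance instModuleSec [VectorBundle ℝ F V] : Module (Fn I P) (Sec I F V) where
  smul f s := ⟨fun x => f x • s x, f.contMDiff.smul_section s.contMDiff⟩
  one_smul s := by ext x; exact one_smul ℝ (s x)
  mul_smul f g s := by ext x; exact mul_smul (f x) (g x) (s x)
  smul_zero f := by ext x; exact smul_zero (f x)
  zero_smul s := by ext x; exact zero_smul ℝ (s x)
  smul_add f s t := by ext x; exact smul_add (f x) (s x) (t x)
  add_smul f g s := by ext x; exact add_smul (f x) (g x) (s x)

theorem smul_sec_apply [VectorBundle ℝ F V] (f : Fn I P) (s : Sec I F V) (x : P) :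
    (f • s) x = f x • s x := rfl

instance instTowerSec [VectorBundle ℝ F V] : IsScalarTower ℝ (Fn I P) (Sec I F V) where
  smul_assoc c f s := by ext x; exact smul_assoc c (f x) (s x)

/-- The directional derivative `W f` of a smooth function along a smooth vector field. -/
def deriv [IsManifold I ∞ P] (W : Sec I EP (TangentSpace I : P → Type _)) (f : Fn I P) :
    Fn I P :=
  ⟨fun x => mfderiv I 𝓘(ℝ, ℝ) f x (W x), by
    have h1 : ContMDiff I 𝓘(ℝ, ℝ).tangent ∞
        (fun x => tangentMap I 𝓘(ℝ, ℝ) f (⟨x, W x⟩ : TangentBundle I P)) :=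
      (f.contMDiff.contMDiff_tangentMap (m := ∞) (by simp)).comp W.contMDiff
    exact (contMDiff_snd_tangentBundle_modelSpace ℝ 𝓘(ℝ, ℝ)).comp h1⟩

section Frames

variable [VectorBundle ℝ F V] [∀ x, IsTopologicalAddGroup (V x)] [∀ x, ContinuousSMul ℝ (V x)]

/-- The pairing `⟨ξ, X⟩` of a section of `V*` with a section of `V`. -/
def pairing (ξ : Sec I (F →L[ℝ] ℝ) (Dual V)) (X : Sec I F V) : Fn I P :=
  ⟨fun x => ξ x (X x), by
    have := ξ.contMDiff.clm_bundle_apply (E₂ := Bundle.Trivial P ℝ) X.contMDiff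
    intro x
    have h := (contMDiffAt_section (E := Bundle.Trivial P ℝ) x).1 (this x)
    exact h⟩

variable [FiniteDimensional ℝ EP] [T2Space P] [IsManifold I ∞ P] [FiniteDimensional ℝ F]
  [ContMDiffVectorBundle ∞ F V I]

theorem contMDiffAt_coeff {ι : Type*} (b : Module.Basis ι ℝ F) (i : ι)
    (e : Trivialization F (TotalSpace.proj : TotalSpace F V → P)) [MemTrivializationAtlas e]
    (x₁ : P) (hx : x₁ ∈ e.baseSet) :
    ContMDiffAt I (I.prod 𝓘(ℝ, F →L[ℝ] ℝ)) ∞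
      (fun x => TotalSpace.mk' (F →L[ℝ] ℝ) (E := Dual V) x
        ((LinearMap.toContinuousLinearMap (b.coord i)).comp (e.continuousLinearMapAt ℝ x))) x₁ := by
  rw [contMDiffAt_hom_bundle]
  refine ⟨contMDiffAt_id, ?_⟩
  have hx' := FiberBundle.mem_baseSet_trivializationAt' (F := F) (E := V) x₁
  have h1 := contMDiffAt_coordChangeL (IB := I) (n := ∞) (F := F) (E := V) hx' hx
  have h2 : ContMDiffAt I 𝓘(ℝ, F →L[ℝ] ℝ) ∞ (fun x =>
     (LinearMap.toContinuousLinearMap (b.coord i)).comp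
      (((trivializationAt F V x₁).coordChangeL ℝ e x : F ≃L[ℝ] F) : F →L[ℝ] F)) x₁ :=
    ContMDiffAt.clm_comp contMDiffAt_const h1
  refine h2.congr_of_eventuallyEq ?_
  filter_upwards [e.open_baseSet.mem_nhds hx,
    (trivializationAt F V x₁).open_baseSet.mem_nhds hx'] with y hy hy'
  ext v
  simp [ContinuousLinearMap.inCoordinates, Trivialization.coordChangeL_apply _ _ ⟨hy', hy⟩, hy, hy',
    Trivialization.coe_linearMapAt_of_mem, Trivialization.symmL_apply]

/-- Around every point there are dual frames of global sections. -/
theorem exists_frame (x₀ : P) : ∃ (r : ℕ) (s : Fin r → Sec I F V)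
    (ξ : Fin r → Sec I (F →L[ℝ] ℝ) (Dual V)) (χ : Fn I P),
    (∀ᶠ x in 𝓝 x₀, χ x = 1) ∧
    ∀ (x : P) (v : V x), (χ x * χ x) • v = ∑ i, (ξ i x v : ℝ) • s i x := by
  let e := trivializationAt F V x₀
  have he : x₀ ∈ e.baseSet := FiberBundle.mem_baseSet_trivializationAt' x₀
  obtain ⟨χ, hχ, -⟩ := (SmoothBumpFunction.nhds_basis_support (I := I)
    (e.open_baseSet.mem_nhds he)).mem_iff.1 (e.open_baseSet.mem_nhds he)
  let b := Module.finBasis ℝ F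
  refine ⟨_, fun i => ⟨fun x => χ x • e.localFrame b i x, ?_⟩,
    fun i => ⟨fun x => χ x • ((LinearMap.toContinuousLinearMap (b.coord i)).comp (e.continuousLinearMapAt ℝ x)), ?_⟩, ⟨χ, χ.contMDiff⟩, χ.eventuallyEq_one, ?_⟩
  · exact ContMDiffOn.smul_section_of_tsupport (s := e.localFrame b i) (χ.contMDiff.contMDiffOn) e.open_baseSet hχ
      (e.contMDiffOn_localFrame_baseSet ∞ b i)
  · refine ContMDiffOn.smul_section_of_tsupport (V := Dual V) (s := fun x => ((LinearMap.toContinuousLinearMap (b.coord i)).comp (e.continuousLinearMapAt ℝ x))) (χ.contMDiff.contMDiffOn) e.open_baseSet hχ ?_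
    intro x hx
    exact (contMDiffAt_coeff b i e x hx).contMDiffWithinAt
  · intro x v
    by_cases hx : x ∈ e.baseSet
    · have h1 : v = ∑ i, b.repr (e.continuousLinearMapAt ℝ x v) i • e.basisAt b hx i := by
        conv_lhs => rw [← (e.basisAt b hx).sum_repr v]
        refine Finset.sum_congr rfl fun i _ => ?_
        simp [Trivialization.basisAt, Trivialization.coe_linearMapAt_of_mem, hx]
      conv_lhs => rw [h1, Finset.smul_sum]
      refine Finset.sum_congr rfl fun i _ => ?_
      change (χ x * χ x) • _ = (χ x * b.repr (e.continuousLinearMapAt ℝ x v) i) •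
        (χ x • e.localFrame b i x)
      rw [Trivialization.localFrame_apply_of_mem_baseSet e b hx, smul_smul, smul_smul]
      congr 1
      ring
    · have : χ x = 0 := image_eq_zero_of_notMem_tsupport fun h => hx (hχ h)
      simp [this]

/-- Every vector extends to a global section. -/
theorem exists_sec_eq (x : P) (v : V x) : ∃ t : Sec I F V, t x = v := by
  obtain ⟨r, s, ξ, χ, h1, h2⟩ := exists_frame (I := I) (F := F) (V := V) x
  refine ⟨∑ i, (ξ i x v : ℝ) • s i, ?_⟩
  have h3 := h2 x v
  rw [h1.self_of_nhds] at h3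
  rw [← ContMDiffSection.coeAddHom_apply, map_sum, Finset.sum_apply]
  simpa using h3.symm

/-- Every covector extends to a global section of the dual bundle. -/
theorem exists_dual_sec_eq (x : P) (η : Dual V x) :
    ∃ t : Sec I (F →L[ℝ] ℝ) (Dual V), t x = η := by
  obtain ⟨r, s, ξ, χ, h1, h2⟩ := exists_frame (I := I) (F := F) (V := V) x
  refine ⟨∑ i, (η (s i x) : ℝ) • ξ i, ?_⟩
  ext v
  have h3 := congrArg η (h2 x v)
  rw [h1.self_of_nhds] at h3
  rw [← ContMDiffSection.coeAddHom_apply, map_sum, Finset.sum_apply]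
  simpa [mul_comm] using h3.symm

theorem linear_apply_eq_zero (φ : Sec I F V →ₗ[Fn I P] Fn I P) (t : Sec I F V) (x : P)
    (ht : t x = 0) : φ t x = 0 := by
  obtain ⟨r, s, ξ, χ, h1, h2⟩ := exists_frame (I := I) (F := F) (V := V) x
  have h3 : (χ * χ) • t = ∑ i, pairing (ξ i) t • s i := by
    ext y
    rw [← ContMDiffSection.coeAddHom_apply (s := ∑ i, _), map_sum, Finset.sum_apply]
    exact h2 y (t y)
  have h4 := congrArg (fun f : Fn I P => f x) (congrArg φ h3)
  simp only [map_smul, map_sum] at h4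
  have h5 : (χ x * χ x) * φ t x = ∑ i, pairing (ξ i) t x * φ (s i) x := by
    have : (∑ i, pairing (ξ i) t • φ (s i) : Fn I P) x
        = ∑ i, (pairing (ξ i) t • φ (s i) : Fn I P) x := by
      rw [← ContMDiffMap.coeFnAddMonoidHom_apply, map_sum, Finset.sum_apply]; rfl
    exact h4.trans this
  rw [h1.self_of_nhds] at h5
  have h6 : ∀ i, pairing (ξ i) t x = 0 := fun i => by
    change (ξ i x (t x) : ℝ) = 0
    rw [ht, map_zero]
  simpa [h6] using h5

/-- A family of covectors is smooth once its pairings with smooth sections are. -/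
theorem contMDiff_dual_of_pairing (α : ∀ x, Dual V x)
    (hα : ∀ t : Sec I F V, ContMDiff I 𝓘(ℝ, ℝ) ∞ (fun x => (α x (t x) : ℝ))) :
    ContMDiff I (I.prod 𝓘(ℝ, F →L[ℝ] ℝ)) ∞
      (fun x => TotalSpace.mk' (F →L[ℝ] ℝ) (E := Dual V) x (α x)) := by
  intro x₀
  obtain ⟨r, s, ξ, χ, h1, h2⟩ := exists_frame (I := I) (F := F) (V := V) x₀
  have h3 : ContMDiffAt I (I.prod 𝓘(ℝ, F →L[ℝ] ℝ)) ∞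
      (fun x => TotalSpace.mk' (F →L[ℝ] ℝ) (E := Dual V) x
        (∑ i, (fun x => (α x (s i x) : ℝ)) x • ξ i x)) x₀ :=
    ContMDiffAt.sum_section fun i _ => ((hα (s i)) x₀).smul_section ((ξ i).contMDiff x₀)
  refine h3.congr_of_eventuallyEq ?_
  filter_upwards [h1] with x hx
  congr 1
  ext v
  have h4 := congrArg (α x) (h2 x v)
  rw [hx] at h4
  simpa [mul_comm] using h4

/-- A family of vectors is smooth once its pairings with smooth sections of the dual are. -/
theorem contMDiff_of_pairing (u : ∀ x, V x)
    (hu : ∀ η : Sec I (F →L[ℝ] ℝ) (Dual V), ContMDiff I 𝓘(ℝ, ℝ) ∞ (fun x => (η x (u x) : ℝ))) :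
    ContMDiff I (I.prod 𝓘(ℝ, F)) ∞ (fun x => TotalSpace.mk' F x (u x)) := by
  intro x₀
  obtain ⟨r, s, ξ, χ, h1, h2⟩ := exists_frame (I := I) (F := F) (V := V) x₀
  have h3 : ContMDiffAt I (I.prod 𝓘(ℝ, F)) ∞ (fun x => TotalSpace.mk' F x
        (∑ i, (fun x => (ξ i x (u x) : ℝ)) x • s i x)) x₀ :=
    ContMDiffAt.sum_section fun i _ => ((hu (ξ i)) x₀).smul_section ((s i).contMDiff x₀)
  refine h3.congr_of_eventuallyEq ?_
  filter_upwards [h1] with x hx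
  congr 1
  have h4 := h2 x (u x)
  rw [hx] at h4
  simpa using h4

/-- `Γ(V*) = Hom(Γ(V), C^∞(P))` over `C^∞(P)`. -/
theorem exists_dual_sec (φ : Sec I F V →ₗ[Fn I P] Fn I P) :
    ∃! α : Sec I (F →L[ℝ] ℝ) (Dual V), ∀ t, pairing α t = φ t := by
  have : ∀ x, FiniteDimensional ℝ (V x) := fun x => VectorBundle.finiteDimensional ℝ F V x
  have : ∀ x, T2Space (V x) := fun x =>
    (VectorBundle.continuousLinearEquivAt ℝ F V x).symm.toHomeomorph.t2Space
  choose ext hext using fun x (v : V x) => exists_sec_eq (I := I) (F := F) (V := V) x v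
  have key : ∀ x (t t' : Sec I F V), t x = t' x → φ t x = φ t' x := by
    intro x t t' h
    have := linear_apply_eq_zero φ (t - t') x (by simp [h])
    rw [map_sub] at this
    exact sub_eq_zero.1 this
  let α : ∀ x, Dual V x := fun x => LinearMap.toContinuousLinearMap
    { toFun := fun v => φ (ext x v) x
      map_add' := fun v w => by
        rw [key x _ (ext x v + ext x w) (by simp [hext]), map_add]; rfl
      map_smul' := fun c v => by
        rw [key x _ (algebraMap ℝ (Fn I P) c • ext x v)
          (by simp [hext]), map_smul]; rfl }
  have hα : ∀ x (t : Sec I F V), (α x (t x) : ℝ) = φ t x := fun x t => key x _ _ (hext x _)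
  refine ⟨⟨α, contMDiff_dual_of_pairing α fun t => ?_⟩, fun t => ?_, fun β hβ => ?_⟩
  · exact (φ t).contMDiff.congr fun x => hα x t
  · ext x; exact hα x t
  · ext x v
    obtain ⟨t, rfl⟩ := exists_sec_eq (I := I) (F := F) (V := V) x v
    have := congrArg (fun f : Fn I P => f x) (hβ t)
    exact this.trans (hα x t).symm

/-- `Γ(V) = Hom(Γ(V*), C^∞(P))` over `C^∞(P)`. -/
theorem exists_sec (φ : Sec I (F →L[ℝ] ℝ) (Dual V) →ₗ[Fn I P] Fn I P) :
    ∃! u : Sec I F V, ∀ ξ, pairing ξ u = φ ξ := by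
  have : ∀ x, FiniteDimensional ℝ (V x) := fun x => VectorBundle.finiteDimensional ℝ F V x
  have : ∀ x, T2Space (V x) := fun x =>
    (VectorBundle.continuousLinearEquivAt ℝ F V x).symm.toHomeomorph.t2Space
  obtain ⟨α, hα, -⟩ := exists_dual_sec φ
  have h1 : ∀ x, ∃ v : V x, ∀ η : Dual V x, (α x η : ℝ) = η v := by
    intro x
    let ψ : Module.Dual ℝ (Module.Dual ℝ (V x)) :=
      { toFun := fun f => (α x (LinearMap.toContinuousLinearMap f : V x →L[ℝ] ℝ) : ℝ)
        map_add' := fun f g => by simp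
        map_smul' := fun c f => by simp }
    obtain ⟨v, hv⟩ := (Module.evalEquiv ℝ (V x)).surjective ψ
    refine ⟨v, fun η => ?_⟩
    have := congrArg (fun f => f (η : V x →ₗ[ℝ] ℝ)) hv
    exact this.symm
  choose u hu using h1
  refine ⟨⟨u, contMDiff_of_pairing u fun η => ?_⟩, fun η => ?_, fun w hw => ?_⟩
  · exact (pairing α η).contMDiff.congr fun x => (hu x (η x)).symm
  · rw [← hα]; ext x; exact (hu x (η x)).symm
  · ext x
    rw [← sub_eq_zero, ← Module.forall_dual_apply_eq_zero_iff ℝ]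
    intro f
    obtain ⟨η, hη⟩ := exists_dual_sec_eq (I := I) (F := F) (V := V) x
      (LinearMap.toContinuousLinearMap f : V x →L[ℝ] ℝ)
    have h2 := congrArg (fun f : Fn I P => f x) (hw η)
    have h3 : (η x (w x) : ℝ) = η x (u x) := by
      refine h2.trans ?_
      rw [← hα]
      exact hu x (η x)
    rw [hη] at h3
    rw [map_sub, sub_eq_zero]
    exact h3

variable (I F V) in
/-- A smooth bundle map `V → TP` over the identity of `P`: a family of linear maps of the fibres
that maps smooth sections to smooth vector fields. -/
structure Anchor where
  toFun : ∀ x, V x →ₗ[ℝ] TangentSpace I x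
  smooth : ∀ X : Sec I F V,
    ContMDiff I I.tangent ∞ (fun x => (⟨x, toFun x (X x)⟩ : TangentBundle I P))

namespace Anchor

/-- The induced map on sections. -/
def map (a : Anchor I F V) (X : Sec I F V) : Sec I EP (TangentSpace I : P → Type _) :=
  ⟨fun x => a.toFun x (X x), a.smooth X⟩

/-- The derivative `a(X) f`. -/
def act (a : Anchor I F V) (X : Sec I F V) (f : Fn I P) : Fn I P := deriv (a.map X) f

theorem act_apply (a : Anchor I F V) (X : Sec I F V) (f : Fn I P) (x : P) :
    a.act X f x = mfderiv I 𝓘(ℝ, ℝ) f x (a.toFun x (X x)) := rfl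

theorem act_add_left (a : Anchor I F V) (X Y : Sec I F V) (f : Fn I P) :
    a.act (X + Y) f = a.act X f + a.act Y f := by
  ext x
  change mfderiv I 𝓘(ℝ, ℝ) f x (a.toFun x (X x + Y x)) = _
  rw [map_add, map_add]; rfl

theorem act_smul_left (a : Anchor I F V) (g : Fn I P) (X : Sec I F V) (f : Fn I P) :
    a.act (g • X) f = g * a.act X f := by
  ext x
  change mfderiv I 𝓘(ℝ, ℝ) f x (a.toFun x (g x • X x)) = _
  rw [map_smul, map_smul]; rfl

theorem act_add (a : Anchor I F V) (X : Sec I F V) (f g : Fn I P) :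
    a.act X (f + g) = a.act X f + a.act X g := by
  ext x
  have hf : MDifferentiableAt I 𝓘(ℝ, ℝ) f x := (f.contMDiff x).mdifferentiableAt (by simp)
  have hg : MDifferentiableAt I 𝓘(ℝ, ℝ) g x := (g.contMDiff x).mdifferentiableAt (by simp)
  exact congrArg (fun L => L (a.toFun x (X x))) (mfderiv_add hf hg)

theorem act_mul (a : Anchor I F V) (X : Sec I F V) (f g : Fn I P) :
    a.act X (f * g) = f * a.act X g + a.act X f * g := by
  ext x
  have hf : MDifferentiableAt I 𝓘(ℝ, ℝ) f x := (f.contMDiff x).mdifferentiableAt (by simp)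
  have hg : MDifferentiableAt I 𝓘(ℝ, ℝ) g x := (g.contMDiff x).mdifferentiableAt (by simp)
  have h := congrArg (fun L => L (a.toFun x (X x))) (hf.hasMFDerivAt.mul hg.hasMFDerivAt).mfderiv
  refine h.trans ?_
  change f x * _ + g x * _ = f x * _ + _ * g x
  rw [mul_comm (g x)]; rfl

theorem act_zero (a : Anchor I F V) (X : Sec I F V) : a.act X 0 = 0 := by
  have := a.act_add X 0 0
  simpa using this

/-- `f ↦ a(X) f` as an additive map. -/
def actHom (a : Anchor I F V) (X : Sec I F V) : Fn I P →+ Fn I P where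
  toFun := a.act X
  map_zero' := a.act_zero X
  map_add' := a.act_add X

theorem act_neg (a : Anchor I F V) (X : Sec I F V) (f : Fn I P) : a.act X (-f) = -a.act X f :=
  (a.actHom X).map_neg f

theorem act_sub (a : Anchor I F V) (X : Sec I F V) (f g : Fn I P) :
    a.act X (f - g) = a.act X f - a.act X g := (a.actHom X).map_sub f g

theorem act_real_smul (a : Anchor I F V) (X : Sec I F V) (c : ℝ) (f : Fn I P) :
    a.act X (c • f) = c • a.act X f := by
  ext x
  have hf : MDifferentiableAt I 𝓘(ℝ, ℝ) f x := (f.contMDiff x).mdifferentiableAt (by simp)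
  exact congrArg (fun L => L (a.toFun x (X x))) (const_smul_mfderiv hf c)

end Anchor

variable (I F V) in
/-- A Lie algebroid structure on the vector bundle `V → P`. -/
structure LieAlgebroid where
  /-- the bracket on `Γ(V)` -/
  bracket : Sec I F V → Sec I F V → Sec I F V
  /-- the anchor `V → TP` -/
  anchor : Anchor I F V
  add_bracket : ∀ X Y Z, bracket (X + Y) Z = bracket X Z + bracket Y Z
  smul_bracket : ∀ (c : ℝ) X Y, bracket (c • X) Y = c • bracket X Y
  skew : ∀ X Y, bracket X Y = -bracket Y X
  jacobi : ∀ X Y Z, bracket (bracket X Y) Z + bracket (bracket Y Z) X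
    + bracket (bracket Z X) Y = 0
  anchor_bracket : ∀ X Y x, anchor.toFun x (bracket X Y x)
    = VectorField.mlieBracket I (anchor.map X) (anchor.map Y) x
  leibniz : ∀ X (f : Fn I P) Y,
    bracket X (f • Y) = f • bracket X Y + anchor.act X f • Y

theorem pairing_add_left (ξ η : Sec I (F →L[ℝ] ℝ) (Dual V)) (X : Sec I F V) :
    pairing (ξ + η) X = pairing ξ X + pairing η X := rfl

theorem pairing_smul_left (f : Fn I P) (ξ : Sec I (F →L[ℝ] ℝ) (Dual V)) (X : Sec I F V) :
    pairing (f • ξ) X = f * pairing ξ X := rfl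

theorem pairing_add (ξ : Sec I (F →L[ℝ] ℝ) (Dual V)) (X Y : Sec I F V) :
    pairing ξ (X + Y) = pairing ξ X + pairing ξ Y := by
  ext x; exact (ξ x).map_add (X x) (Y x)

theorem pairing_smul (ξ : Sec I (F →L[ℝ] ℝ) (Dual V)) (f : Fn I P) (X : Sec I F V) :
    pairing ξ (f • X) = f * pairing ξ X := by
  ext x; exact (ξ x).map_smul (f x) (X x)

theorem pairing_sub (ξ : Sec I (F →L[ℝ] ℝ) (Dual V)) (X Y : Sec I F V) :
    pairing ξ (X - Y) = pairing ξ X - pairing ξ Y := by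
  ext x; exact (ξ x).map_sub (X x) (Y x)

/-- The section of `V*` with `⟨ofDual φ, X⟩ = φ X` for all `X`. -/
def ofDual (φ : Sec I F V →ₗ[Fn I P] Fn I P) : Sec I (F →L[ℝ] ℝ) (Dual V) :=
  (exists_dual_sec φ).choose

theorem pairing_ofDual (φ : Sec I F V →ₗ[Fn I P] Fn I P) (X : Sec I F V) :
    pairing (ofDual φ) X = φ X := (exists_dual_sec φ).choose_spec.1 X

/-- The section of `V` with `⟨ξ, ofBidual φ⟩ = φ ξ` for all `ξ`. -/
def ofBidual (φ : Sec I (F →L[ℝ] ℝ) (Dual V) →ₗ[Fn I P] Fn I P) : Sec I F V :=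
  (exists_sec φ).choose

theorem pairing_ofBidual (φ : Sec I (F →L[ℝ] ℝ) (Dual V) →ₗ[Fn I P] Fn I P)
    (ξ : Sec I (F →L[ℝ] ℝ) (Dual V)) : pairing ξ (ofBidual φ) = φ ξ :=
  (exists_sec φ).choose_spec.1 ξ

theorem ext_of_pairing {X Y : Sec I F V}
    (h : ∀ ξ : Sec I (F →L[ℝ] ℝ) (Dual V), pairing ξ X = pairing ξ Y) : X = Y := by
  let φ : Sec I (F →L[ℝ] ℝ) (Dual V) →ₗ[Fn I P] Fn I P :=
    { toFun := fun ξ => pairing ξ Y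
      map_add' := fun _ _ => rfl
      map_smul' := fun _ _ => rfl }
  exact (exists_sec φ).unique (y₁ := X) (y₂ := Y) h (fun _ => rfl)

namespace LieAlgebroid

theorem bracket_add (L : LieAlgebroid I F V) (X Y Z : Sec I F V) :
    L.bracket X (Y + Z) = L.bracket X Y + L.bracket X Z := by
  rw [L.skew, L.add_bracket, neg_add, ← L.skew, ← L.skew]

theorem bracket_smul (L : LieAlgebroid I F V) (c : ℝ) (X Y : Sec I F V) :
    L.bracket X (c • Y) = c • L.bracket X Y := by
  rw [L.skew, L.smul_bracket, ← smul_neg, ← L.skew]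

theorem leibniz_left (L : LieAlgebroid I F V) (X : Sec I F V) (f : Fn I P) (Y : Sec I F V) :
    L.bracket (f • X) Y = f • L.bracket X Y - L.anchor.act Y f • X := by
  rw [L.skew, L.leibniz, neg_add, ← smul_neg, ← L.skew, sub_eq_add_neg]

/-- The differential `d f ∈ Γ(V*)` of a function: `⟨d f, X⟩ = a(X) f`. -/
def d₀ (L : LieAlgebroid I F V) (f : Fn I P) : Sec I (F →L[ℝ] ℝ) (Dual V) :=
  ofDual
    { toFun := fun X => L.anchor.act X f
      map_add' := fun X Y => L.anchor.act_add_left X Y f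
      map_smul' := fun g X => L.anchor.act_smul_left g X f }

/-- The Lie derivative `L_X ξ ∈ Γ(V*)` for `X ∈ Γ(V)`, `ξ ∈ Γ(V*)`:
`⟨L_X ξ, Y⟩ = a(X)⟨ξ, Y⟩ - ⟨ξ, [X, Y]⟩`. -/
def lieDeriv (L : LieAlgebroid I F V) (X : Sec I F V) (ξ : Sec I (F →L[ℝ] ℝ) (Dual V)) :
    Sec I (F →L[ℝ] ℝ) (Dual V) :=
  ofDual
    { toFun := fun Y => L.anchor.act X (pairing ξ Y) - pairing ξ (L.bracket X Y)
      map_add' := fun Y Z => by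
        rw [pairing_add, L.bracket_add, pairing_add, L.anchor.act_add]; abel
      map_smul' := fun f Y => by
        rw [pairing_smul, L.leibniz, pairing_add, pairing_smul, pairing_smul, L.anchor.act_mul,
          RingHom.id_apply, smul_eq_mul]
        ring }

/-- For a Lie algebroid structure on `V*`, the differential `d_* f ∈ Γ(V)` of a function:
`⟨ξ, d_* f⟩ = a_*(ξ) f`. -/
def dStar₀ (L : LieAlgebroid I (F →L[ℝ] ℝ) (Dual V)) (f : Fn I P) : Sec I F V :=
  ofBidual
    { toFun := fun ξ => L.anchor.act ξ f
      map_add' := fun X Y => L.anchor.act_add_left X Y f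
      map_smul' := fun g X => L.anchor.act_smul_left g X f }

/-- For a Lie algebroid structure on `V*`, the Lie derivative `L_ξ X ∈ Γ(V)` for `ξ ∈ Γ(V*)`,
`X ∈ Γ(V)`: `⟨η, L_ξ X⟩ = a_*(ξ)⟨η, X⟩ - ⟨[ξ, η], X⟩`. -/
def lieDerivStar (L : LieAlgebroid I (F →L[ℝ] ℝ) (Dual V)) (ξ : Sec I (F →L[ℝ] ℝ) (Dual V))
    (X : Sec I F V) : Sec I F V :=
  ofBidual
    { toFun := fun η => L.anchor.act ξ (pairing η X) - pairing (L.bracket ξ η) X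
      map_add' := fun Y Z => by
        rw [pairing_add_left, L.bracket_add, pairing_add_left, L.anchor.act_add]; abel
      map_smul' := fun f Y => by
        rw [pairing_smul_left, L.leibniz, pairing_add_left, pairing_smul_left, pairing_smul_left,
          L.anchor.act_mul, RingHom.id_apply, smul_eq_mul]
        ring }

end LieAlgebroid

theorem LieAlgebroid.isDerivationPair (L : LieAlgebroid I F V) :
    IsDerivationPair L.anchor.act L.bracket where
  act_add_left := L.anchor.act_add_left
  act_smul_left := L.anchor.act_smul_left
  act_add := L.anchor.act_add
  act_mul := L.anchor.act_mul
  add_br := L.add_bracket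
  br_skew := L.skew
  br_smul := L.leibniz
  two_torsion f hf := by
    have : (2 : ℝ) • f = 0 := by rw [two_smul, hf]
    exact (smul_eq_zero_iff_right two_ne_zero).1 this

variable (I F V) in
/-- `Γ(⋀^k V*)`: alternating `C^∞(P)`-multilinear forms on `Γ(V)`. -/
abbrev Form (k : ℕ) := (Sec I F V) [⋀^Fin k]→ₗ[Fn I P] (Fn I P)

/-- The differential `Γ(⋀^k V*) → Γ(⋀^{k+1} V*)` of a Lie algebroid `V`. -/
def LieAlgebroid.d (L : LieAlgebroid I F V) {k : ℕ} (φ : Form I F V k) :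
    Form I F V (k + 1) :=
  L.isDerivationPair.koszulForm φ

variable (I F V) in
/-- `Γ(⋀^k V)`: alternating `C^∞(P)`-multilinear forms on `Γ(V*)`. The wedge product of
`X₁, …, X_k ∈ Γ(V)` is the form `(ξ₁, …, ξ_k) ↦ det ⟨ξᵢ, Xⱼ⟩`. -/
abbrev MultiVec (k : ℕ) := Form I (F →L[ℝ] ℝ) (Dual V) k

/-- The contraction of all but the first argument of a multivector: the section of `V` with
`⟨ξ, sharp Q η⟩ = Q(ξ, η₁, …, η_a)`. -/
def sharp {a : ℕ} (Q : MultiVec I F V (a + 1))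
    (η : Fin a → Sec I (F →L[ℝ] ℝ) (Dual V)) : Sec I F V :=
  ofBidual
    { toFun := fun ξ => Q.curryLeft ξ η
      map_add' := fun ξ ζ => by rw [map_add]; rfl
      map_smul' := fun f ξ => by rw [map_smul]; rfl }

theorem pairing_sharp {a : ℕ} (Q : MultiVec I F V (a + 1))
    (η : Fin a → Sec I (F →L[ℝ] ℝ) (Dual V)) (ξ : Sec I (F →L[ℝ] ℝ) (Dual V)) :
    pairing ξ (sharp Q η) = Q.curryLeft ξ η := pairing_ofBidual _ ξ

theorem sharp_update_add {a : ℕ} (Q : MultiVec I F V (a + 1))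
    (η : Fin a → Sec I (F →L[ℝ] ℝ) (Dual V)) (i : Fin a) (x y : Sec I (F →L[ℝ] ℝ) (Dual V)) :
    sharp Q (Function.update η i (x + y))
      = sharp Q (Function.update η i x) + sharp Q (Function.update η i y) := by
  apply ext_of_pairing
  intro ξ
  rw [pairing_add, pairing_sharp, pairing_sharp, pairing_sharp, AlternatingMap.map_update_add]

theorem sharp_update_smul {a : ℕ} (Q : MultiVec I F V (a + 1))
    (η : Fin a → Sec I (F →L[ℝ] ℝ) (Dual V)) (i : Fin a) (f : Fn I P)
    (x : Sec I (F →L[ℝ] ℝ) (Dual V)) :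
    sharp Q (Function.update η i (f • x)) = f • sharp Q (Function.update η i x) := by
  apply ext_of_pairing
  intro ξ
  rw [pairing_smul, pairing_sharp, pairing_sharp, AlternatingMap.map_update_smul, smul_eq_mul]

theorem curryLeft_swap {k : ℕ} (Q : MultiVec I F V (k + 1)) (ξ : Sec I (F →L[ℝ] ℝ) (Dual V))
    (θ : Fin k → Sec I (F →L[ℝ] ℝ) (Dual V)) (i : Fin k) :
    Q.curryLeft (θ i) (Function.update θ i ξ) = -Q.curryLeft ξ θ := by
  have h := Q.map_swap (Matrix.vecCons ξ θ) (Fin.succ_ne_zero i).symm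
  rw [AlternatingMap.curryLeft_apply_apply, AlternatingMap.curryLeft_apply_apply, ← h]
  congr 1
  ext j : 1
  refine Fin.cases ?_ (fun j => ?_) j
  · simp
  · rcases eq_or_ne j i with rfl | hj
    · simp
    · rw [Function.comp_apply, Equiv.swap_apply_of_ne_of_ne (Fin.succ_ne_zero j)
        (fun h => hj (Fin.succ_injective _ h))]
      simp [Function.update_of_ne hj]

namespace LieAlgebroid

variable {a b : ℕ}

/-- The expression antisymmetrized in the Schouten bracket. For `a = b = 0` it is `⟨ξ, [X, Y]⟩`;
in general the last two terms compensate that differentiation along `sharp P η` (`sharp Q θ`) should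
reach each factor of `Q` (of `P`) just once. -/
def schoutenTerm (L : LieAlgebroid I F V) (P' : MultiVec I F V (a + 1))
    (Q : MultiVec I F V (b + 1)) (ξ : Sec I (F →L[ℝ] ℝ) (Dual V))
    (η : Fin a → Sec I (F →L[ℝ] ℝ) (Dual V)) (θ : Fin b → Sec I (F →L[ℝ] ℝ) (Dual V)) : Fn I P :=
  pairing ξ (L.bracket (sharp P' η) (sharp Q θ))
    - ((b : ℝ) / (b + 1)) • L.anchor.act (sharp P' η) (Q.curryLeft ξ θ)
    + ((a : ℝ) / (a + 1)) • L.anchor.act (sharp Q θ) (P'.curryLeft ξ η)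

/-- `schoutenTerm` with its arguments listed in one tuple. -/
def schoutenTuple (L : LieAlgebroid I F V) (P' : MultiVec I F V (a + 1))
    (Q : MultiVec I F V (b + 1)) (ζ : Fin (a + b + 1) → Sec I (F →L[ℝ] ℝ) (Dual V)) : Fn I P :=
  L.schoutenTerm P' Q (ζ 0) (fun i => ζ (Fin.castAdd b i).succ) (fun i => ζ (Fin.natAdd a i).succ)

theorem forall_slot {p : Fin (a + b + 1) → Prop} (h0 : p 0)
    (h1 : ∀ i : Fin a, p (Fin.castAdd b i).succ) (h2 : ∀ i : Fin b, p (Fin.natAdd a i).succ) :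
    ∀ k, p k := by
  intro k
  refine Fin.cases h0 (fun k => ?_) k
  exact Fin.addCases h1 h2 k

theorem schoutenTuple_update_zero (L : LieAlgebroid I F V) (P' : MultiVec I F V (a + 1))
    (Q : MultiVec I F V (b + 1)) (ζ : Fin (a + b + 1) → Sec I (F →L[ℝ] ℝ) (Dual V))
    (y : Sec I (F →L[ℝ] ℝ) (Dual V)) :
    L.schoutenTuple P' Q (Function.update ζ 0 y) = L.schoutenTerm P' Q y
      (fun i => ζ (Fin.castAdd b i).succ) (fun i => ζ (Fin.natAdd a i).succ) := by
  simp [schoutenTuple]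

theorem update_slot_left {X : Type*} (ζ : Fin (a + b + 1) → X) (i : Fin a) (y : X) :
    (fun j : Fin a => Function.update ζ (Fin.castAdd b i).succ y (Fin.castAdd b j).succ)
      = Function.update (fun j : Fin a => ζ (Fin.castAdd b j).succ) i y := by
  ext j
  rcases eq_or_ne j i with rfl | hj
  · simp
  · rw [Function.update_of_ne hj, Function.update_of_ne]
    intro h
    exact hj (Fin.castAdd_injective a b (Fin.succ_injective _ h))

theorem update_slot_left' {X : Type*} (ζ : Fin (a + b + 1) → X) (i : Fin a) (y : X) :
    (fun j : Fin b => Function.update ζ (Fin.castAdd b i).succ y (Fin.natAdd a j).succ)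
      = (fun j : Fin b => ζ (Fin.natAdd a j).succ) := by
  ext j
  rw [Function.update_of_ne]
  intro h
  have := congrArg Fin.val (Fin.succ_injective _ h)
  simp at this
  omega

theorem update_slot_right {X : Type*} (ζ : Fin (a + b + 1) → X) (i : Fin b) (y : X) :
    (fun j : Fin b => Function.update ζ (Fin.natAdd a i).succ y (Fin.natAdd a j).succ)
      = Function.update (fun j : Fin b => ζ (Fin.natAdd a j).succ) i y := by
  ext j
  rcases eq_or_ne j i with rfl | hj
  · simp
  · rw [Function.update_of_ne hj, Function.update_of_ne]
    intro h
    exact hj (Fin.natAdd_injective b a (Fin.succ_injective _ h))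

theorem update_slot_right' {X : Type*} (ζ : Fin (a + b + 1) → X) (i : Fin b) (y : X) :
    (fun j : Fin a => Function.update ζ (Fin.natAdd a i).succ y (Fin.castAdd b j).succ)
      = (fun j : Fin a => ζ (Fin.castAdd b j).succ) := by
  ext j
  rw [Function.update_of_ne]
  intro h
  have := congrArg Fin.val (Fin.succ_injective _ h)
  simp at this
  omega

theorem schoutenTuple_update_left (L : LieAlgebroid I F V) (P' : MultiVec I F V (a + 1))
    (Q : MultiVec I F V (b + 1)) (ζ : Fin (a + b + 1) → Sec I (F →L[ℝ] ℝ) (Dual V))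
    (i : Fin a) (y : Sec I (F →L[ℝ] ℝ) (Dual V)) :
    L.schoutenTuple P' Q (Function.update ζ (Fin.castAdd b i).succ y) = L.schoutenTerm P' Q (ζ 0)
      (Function.update (fun i => ζ (Fin.castAdd b i).succ) i y)
      (fun i => ζ (Fin.natAdd a i).succ) := by
  rw [schoutenTuple, update_slot_left, update_slot_left',
    Function.update_of_ne (Fin.succ_ne_zero _).symm]

theorem schoutenTuple_update_right (L : LieAlgebroid I F V) (P' : MultiVec I F V (a + 1))
    (Q : MultiVec I F V (b + 1)) (ζ : Fin (a + b + 1) → Sec I (F →L[ℝ] ℝ) (Dual V))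
    (i : Fin b) (y : Sec I (F →L[ℝ] ℝ) (Dual V)) :
    L.schoutenTuple P' Q (Function.update ζ (Fin.natAdd a i).succ y) = L.schoutenTerm P' Q (ζ 0)
      (fun i => ζ (Fin.castAdd b i).succ)
      (Function.update (fun i => ζ (Fin.natAdd a i).succ) i y) := by
  rw [schoutenTuple, update_slot_right, update_slot_right',
    Function.update_of_ne (Fin.succ_ne_zero _).symm]

theorem schoutenTuple_add (L : LieAlgebroid I F V) (P' : MultiVec I F V (a + 1))
    (Q : MultiVec I F V (b + 1)) (ζ : Fin (a + b + 1) → Sec I (F →L[ℝ] ℝ) (Dual V)) :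
    ∀ (k : Fin (a + b + 1)) (x y : Sec I (F →L[ℝ] ℝ) (Dual V)),
    L.schoutenTuple P' Q (Function.update ζ k (x + y))
      = L.schoutenTuple P' Q (Function.update ζ k x)
        + L.schoutenTuple P' Q (Function.update ζ k y) := by
  refine forall_slot ?_ ?_ ?_
  · intro x y
    simp only [schoutenTuple_update_zero, schoutenTerm, pairing_add_left, map_add,
      AlternatingMap.add_apply, L.anchor.act_add, smul_add]
    abel
  · intro i x y
    simp only [schoutenTuple_update_left, schoutenTerm, sharp_update_add, L.add_bracket,
      pairing_add, L.anchor.act_add_left, AlternatingMap.map_update_add, L.anchor.act_add, smul_add]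
    abel
  · intro i x y
    simp only [schoutenTuple_update_right, schoutenTerm, sharp_update_add, L.bracket_add,
      pairing_add, L.anchor.act_add_left, AlternatingMap.map_update_add, L.anchor.act_add, smul_add]
    abel

/-- Auxiliary terms. -/
def slotTerm (L : LieAlgebroid I F V) (P' : MultiVec I F V (a + 1))
    (Q : MultiVec I F V (b + 1)) (f : Fn I P)
    (ζ : Fin (a + b + 1) → Sec I (F →L[ℝ] ℝ) (Dual V)) : Fn I P :=
  L.anchor.act (sharp P' (fun i => ζ (Fin.castAdd b i).succ)) f
    * Q.curryLeft (ζ 0) (fun i => ζ (Fin.natAdd a i).succ)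

/-- Auxiliary terms. -/
def slotTerm' (L : LieAlgebroid I F V) (P' : MultiVec I F V (a + 1))
    (Q : MultiVec I F V (b + 1)) (f : Fn I P)
    (ζ : Fin (a + b + 1) → Sec I (F →L[ℝ] ℝ) (Dual V)) : Fn I P :=
  L.anchor.act (sharp Q (fun i => ζ (Fin.natAdd a i).succ)) f
    * P'.curryLeft (ζ 0) (fun i => ζ (Fin.castAdd b i).succ)

/-- Auxiliary weights. -/
def weight (a b : ℕ) : Fin (a + b + 1) → ℝ :=
  Fin.cons (-((b : ℝ) / (b + 1))) (Fin.addCases (fun _ : Fin a => 0) (fun _ : Fin b => 1 / (b + 1)))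

/-- Auxiliary weights. -/
def weight' (a b : ℕ) : Fin (a + b + 1) → ℝ :=
  Fin.cons ((a : ℝ) / (a + 1)) (Fin.addCases (fun _ : Fin a => -(1 / (a + 1))) (fun _ : Fin b => 0))

theorem sum_weight (a b : ℕ) : ∑ k, weight a b k = 0 := by
  rw [Fin.sum_univ_succ, Fin.sum_univ_add]
  simp [weight]
  ring

theorem sum_weight' (a b : ℕ) : ∑ k, weight' a b k = 0 := by
  rw [Fin.sum_univ_succ, Fin.sum_univ_add]
  simp [weight']
  ring

theorem schoutenTuple_smul (L : LieAlgebroid I F V) (P' : MultiVec I F V (a + 1))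
    (Q : MultiVec I F V (b + 1)) (f : Fn I P)
    (ζ : Fin (a + b + 1) → Sec I (F →L[ℝ] ℝ) (Dual V)) :
    ∀ k : Fin (a + b + 1), L.schoutenTuple P' Q (Function.update ζ k (f • ζ k))
      - f * L.schoutenTuple P' Q ζ
      = weight a b k • L.slotTerm P' Q f ζ + weight' a b k • L.slotTerm' P' Q f ζ := by
  have hw : ∀ n : ℕ, (n : ℝ) / (n + 1) = 1 - 1 / (n + 1) := fun n => by
    field_simp; ring
  refine forall_slot ?_ ?_ ?_
  · rw [schoutenTuple_update_zero]
    simp only [schoutenTuple, schoutenTerm, slotTerm, slotTerm', weight, weight', Fin.cons_zero,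
      pairing_smul_left, map_smul, AlternatingMap.smul_apply, smul_eq_mul, L.anchor.act_mul,
      Algebra.smul_def, map_neg]
    ring
  · intro i
    rw [schoutenTuple_update_left]
    simp only [schoutenTuple, schoutenTerm, slotTerm, slotTerm', weight, weight', Fin.cons_succ,
      Fin.addCases_left, sharp_update_smul, AlternatingMap.map_update_smul, Function.update_eq_self,
      L.leibniz_left, L.anchor.act_smul_left, smul_eq_mul, L.anchor.act_mul, zero_smul,
      pairing_sub, pairing_smul, pairing_sharp]
    rw [hw a]
    simp only [Algebra.smul_def, map_sub, map_one, map_neg]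
    ring
  · intro i
    rw [schoutenTuple_update_right]
    simp only [schoutenTuple, schoutenTerm, slotTerm, slotTerm', weight, weight', Fin.cons_succ,
      Fin.addCases_right, sharp_update_smul, AlternatingMap.map_update_smul, Function.update_eq_self,
      L.leibniz, L.anchor.act_smul_left, smul_eq_mul, L.anchor.act_mul, zero_smul,
      pairing_add, pairing_smul, pairing_sharp]
    rw [hw b]
    simp only [Algebra.smul_def, map_sub, map_one]
    ring

theorem slotTerm_swap (L : LieAlgebroid I F V) (P' : MultiVec I F V (a + 1))
    (Q : MultiVec I F V (b + 1)) (f : Fn I P) :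
    ∀ k : Fin (a + b + 1), k ≠ 0 → weight a b k ≠ 0 →
      ∀ ζ, L.slotTerm P' Q f (ζ ∘ Equiv.swap 0 k) = -L.slotTerm P' Q f ζ := by
  refine forall_slot (fun h => absurd rfl h) (fun i _ h => absurd (by simp [weight]) h) ?_
  intro i _ _ ζ
  have e : ζ ∘ Equiv.swap 0 (Fin.natAdd a i).succ
      = Function.update (Function.update ζ (Fin.natAdd a i).succ (ζ 0)) 0
        (ζ (Fin.natAdd a i).succ) := by
    rw [Equiv.comp_swap_eq_update]
  rw [e]
  have h1 : ∀ (ζ' : Fin (a + b + 1) → Sec I (F →L[ℝ] ℝ) (Dual V)) (y),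
      L.slotTerm P' Q f (Function.update ζ' 0 y)
      = L.anchor.act (sharp P' (fun i => ζ' (Fin.castAdd b i).succ)) f
        * Q.curryLeft y (fun i => ζ' (Fin.natAdd a i).succ) := by
    intro ζ' y; simp [slotTerm]
  rw [h1, update_slot_right, update_slot_right', slotTerm, ← mul_neg]
  congr 1
  exact curryLeft_swap Q (ζ 0) (fun i => ζ (Fin.natAdd a i).succ) i

theorem slotTerm'_swap (L : LieAlgebroid I F V) (P' : MultiVec I F V (a + 1))
    (Q : MultiVec I F V (b + 1)) (f : Fn I P) :
    ∀ k : Fin (a + b + 1), k ≠ 0 → weight' a b k ≠ 0 →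
      ∀ ζ, L.slotTerm' P' Q f (ζ ∘ Equiv.swap 0 k) = -L.slotTerm' P' Q f ζ := by
  refine forall_slot (fun h => absurd rfl h) ?_ (fun i _ h => absurd (by simp [weight']) h)
  intro i _ _ ζ
  have e : ζ ∘ Equiv.swap 0 (Fin.castAdd b i).succ
      = Function.update (Function.update ζ (Fin.castAdd b i).succ (ζ 0)) 0
        (ζ (Fin.castAdd b i).succ) := by
    rw [Equiv.comp_swap_eq_update]
  rw [e]
  have h1 : ∀ (ζ' : Fin (a + b + 1) → Sec I (F →L[ℝ] ℝ) (Dual V)) (y),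
      L.slotTerm' P' Q f (Function.update ζ' 0 y)
      = L.anchor.act (sharp Q (fun i => ζ' (Fin.natAdd a i).succ)) f
        * P'.curryLeft y (fun i => ζ' (Fin.castAdd b i).succ) := by
    intro ζ' y; simp [slotTerm']
  rw [h1, update_slot_left, update_slot_left', slotTerm', ← mul_neg]
  congr 1
  exact curryLeft_swap P' (ζ 0) (fun i => ζ (Fin.castAdd b i).succ) i

theorem schoutenTuple_alt (L : LieAlgebroid I F V) (P' : MultiVec I F V (a + 1))
    (Q : MultiVec I F V (b + 1)) (f : Fn I P) (m : Fin (a + b + 1))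
    (ξ : Fin (a + b + 1) → Sec I (F →L[ℝ] ℝ) (Dual V)) :
    ∑ σ : Equiv.Perm (Fin (a + b + 1)), (Equiv.Perm.sign σ : ℤ) •
      (L.schoutenTuple P' Q (Function.update (ξ ∘ σ) (σ.symm m) (f • ξ m))
        - f * L.schoutenTuple P' Q (ξ ∘ σ)) = 0 := by
  have h : ∀ σ : Equiv.Perm (Fin (a + b + 1)),
      L.schoutenTuple P' Q (Function.update (ξ ∘ σ) (σ.symm m) (f • ξ m))
        - f * L.schoutenTuple P' Q (ξ ∘ σ)
      = weight a b (σ.symm m) • L.slotTerm P' Q f (ξ ∘ σ)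
        + weight' a b (σ.symm m) • L.slotTerm' P' Q f (ξ ∘ σ) := by
    intro σ
    rw [← L.schoutenTuple_smul P' Q f (ξ ∘ σ) (σ.symm m)]
    simp
  simp only [h, smul_add, Finset.sum_add_distrib]
  rw [altSum_eq_zero _ _ 0 (L.slotTerm_swap P' Q f) (sum_weight a b),
    altSum_eq_zero _ _ 0 (L.slotTerm'_swap P' Q f) (sum_weight' a b), add_zero]

/-- The Schouten bracket of multivectors `P'`, `Q` of positive degrees `a + 1`, `b + 1`:
`[P', Q](ξ₀, …, ξ_{a+b})` is `1 / (a! b!)` times the sum over all permutations `σ` of the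
expression `schoutenTerm` at `ξ_{σ 0}`, `(ξ_{σ 1}, …, ξ_{σ a})`, `(ξ_{σ (a+1)}, …, ξ_{σ (a+b)})`,
with sign. On decomposable multivectors this is
`[X₀ ∧ ⋯ ∧ X_a, Y₀ ∧ ⋯ ∧ Y_b] = ∑ (-1)^{i+j} [Xᵢ, Yⱼ] ∧ X₀ ∧ ⋯ X̂ᵢ ⋯ ∧ X_a ∧ Y₀ ∧ ⋯ Ŷⱼ ⋯ ∧ Y_b`. -/
def schoutenPos (L : LieAlgebroid I F V) (P' : MultiVec I F V (a + 1))
    (Q : MultiVec I F V (b + 1)) : MultiVec I F V (a + b + 1) :=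
  (1 / ((a.factorial : ℝ) * b.factorial)) •
    altSumForm (L.schoutenTuple P' Q) (L.schoutenTuple_add P' Q) (L.schoutenTuple_alt P' Q)

/-- The Schouten bracket `[P', Q] ∈ Γ(⋀^n V)` of `P' ∈ Γ(⋀^p V)` and `Q ∈ Γ(⋀^q V)`, where
`p + q = n + 1`. With a function it is given by contraction with its differential,
`[P', f] = (-1)^{p-1} P'(d f, …)` and `[f, Q] = -Q(d f, …)`; in particular `[X, f] = a(X) f`. -/
def schouten (L : LieAlgebroid I F V) {n : ℕ} : ∀ {p q : ℕ}, p + q = n + 1 →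
    MultiVec I F V p → MultiVec I F V q → MultiVec I F V n
  | 0, 0, h, _, _ => absurd h (Nat.succ_ne_zero n).symm
  | a + 1, 0, h, P', f =>
      (-1 : ℤ) ^ a • (P'.curryLeft (L.d₀ (f ![]))).domDomCongr (finCongr (by omega))
  | 0, b + 1, h, f, Q => -(Q.curryLeft (L.d₀ (f ![]))).domDomCongr (finCongr (by omega))
  | _ + 1, _ + 1, h, P', Q => (L.schoutenPos P' Q).domDomCongr (finCongr (by omega))

end LieAlgebroid

variable (I F V) in
/-- A smooth symmetric nondegenerate bilinear form on the fibres of `V`. -/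
structure BundleForm where
  form : ∀ x, V x →ₗ[ℝ] V x →ₗ[ℝ] ℝ
  smooth : ∀ e₁ e₂ : Sec I F V, ContMDiff I 𝓘(ℝ, ℝ) ∞ (fun x => form x (e₁ x) (e₂ x))
  symm : ∀ x u v, form x u v = form x v u
  nondegenerate : ∀ x u, (∀ v, form x u v = 0) → u = 0

/-- The function `(e₁, e₂)`. -/
def BundleForm.fn (g : BundleForm I F V) (e₁ e₂ : Sec I F V) : Fn I P :=
  ⟨fun x => g.form x (e₁ x) (e₂ x), g.smooth e₁ e₂⟩

variable (I F V) in
/-- A Courant algebroid structure on the vector bundle `V → P`. -/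
structure CourantAlgebroid where
  /-- the form `( , )` -/
  metric : BundleForm I F V
  /-- the bracket on `Γ(V)` -/
  bracket : Sec I F V → Sec I F V → Sec I F V
  /-- the bundle map `ρ : V → TP` -/
  anchor : Anchor I F V
  /-- the operator `𝒟 : C^∞(P) → Γ(V)`, determined by the form and the anchor -/
  D : Fn I P → Sec I F V
  add_bracket : ∀ e₁ e₂ e₃, bracket (e₁ + e₂) e₃ = bracket e₁ e₃ + bracket e₂ e₃
  smul_bracket : ∀ (c : ℝ) e₁ e₂, bracket (c • e₁) e₂ = c • bracket e₁ e₂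
  skew : ∀ e₁ e₂, bracket e₁ e₂ = -bracket e₂ e₁
  /-- `(𝒟 f, e) = ½ ρ(e) f` -/
  metric_D : ∀ f e, metric.fn (D f) e = (1 / 2 : ℝ) • anchor.act e f
  /-- `[[e₁, e₂], e₃] + c.p. = 𝒟 T(e₁, e₂, e₃)`, where `T = ⅓ ([e₁, e₂], e₃) + c.p.` -/
  jacobi : ∀ e₁ e₂ e₃,
    bracket (bracket e₁ e₂) e₃ + bracket (bracket e₂ e₃) e₁ + bracket (bracket e₃ e₁) e₂
      = D ((1 / 3 : ℝ) • (metric.fn (bracket e₁ e₂) e₃ + metric.fn (bracket e₂ e₃) e₁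
          + metric.fn (bracket e₃ e₁) e₂))
  /-- `ρ[e₁, e₂] = [ρ e₁, ρ e₂]` -/
  anchor_bracket : ∀ e₁ e₂ x, anchor.toFun x (bracket e₁ e₂ x)
    = VectorField.mlieBracket I (anchor.map e₁) (anchor.map e₂) x
  /-- `[e₁, f e₂] = f [e₁, e₂] + (ρ(e₁) f) e₂ - (e₁, e₂) 𝒟 f` -/
  leibniz : ∀ e₁ (f : Fn I P) e₂, bracket e₁ (f • e₂)
    = f • bracket e₁ e₂ + anchor.act e₁ f • e₂ - metric.fn e₁ e₂ • D f
  /-- `ρ ∘ 𝒟 = 0` -/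
  anchor_D : ∀ f, anchor.map (D f) = 0
  /-- `(𝒟 f, 𝒟 g) = 0` -/
  metric_D_D : ∀ f g, metric.fn (D f) (D g) = 0
  /-- `ρ(e)(h₁, h₂) = ([e, h₁] + 𝒟(e, h₁), h₂) + (h₁, [e, h₂] + 𝒟(e, h₂))` -/
  act_metric : ∀ e h₁ h₂, anchor.act e (metric.fn h₁ h₂)
    = metric.fn (bracket e h₁ + D (metric.fn e h₁)) h₂
      + metric.fn h₁ (bracket e h₂ + D (metric.fn e h₂))

/-- A Lie bialgebroid: Lie algebroid structures `L` on `V` and `L'` on `V*` such that the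
differential `d_*` of `L'` is a derivation of the Schouten bracket of `L`,
`d_*[P', Q] = [d_* P', Q] + (-1)^{p-1} [P', d_* Q]` for `P' ∈ Γ(⋀^p V)`, `Q ∈ Γ(⋀^q V)`.
The case `p = q = 0`, where `[f, g] = 0`, is written separately. -/
structure IsLieBialgebroid (L : LieAlgebroid I F V)
    (L' : LieAlgebroid I (F →L[ℝ] ℝ) (Dual V)) : Prop where
  d_schouten : ∀ {p q n : ℕ} (h : p + q = n + 1) (P' : MultiVec I F V p) (Q : MultiVec I F V q),
    L'.d (L.schouten h P' Q)
      = L.schouten (show (p + 1) + q = (n + 1) + 1 by omega) (L'.d P') Q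
        + (-1 : ℤ) ^ (p + 1) • L.schouten (show p + (q + 1) = (n + 1) + 1 by omega) P' (L'.d Q)
  d_schouten_zero : ∀ f g : MultiVec I F V 0,
    0 = L.schouten (show 1 + 0 = 0 + 1 by omega) (L'.d f) g
      - L.schouten (show 0 + 1 = 0 + 1 by omega) f (L'.d g)

theorem contMDiff_fst_snd {F₂ : Type*} [NormedAddCommGroup F₂] [NormedSpace ℝ F₂]
    {W : P → Type*} [∀ x, AddCommGroup (W x)] [∀ x, Module ℝ (W x)] [∀ x, TopologicalSpace (W x)]
    [TopologicalSpace (TotalSpace F₂ W)] [FiberBundle F₂ W] (X : ∀ x, V x) (Y : ∀ x, W x) :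
    ContMDiff I (I.prod 𝓘(ℝ, F × F₂)) ∞
        (fun x => TotalSpace.mk' (F × F₂) (E := V ×ᵇ W) x (X x, Y x)) ↔
      ContMDiff I (I.prod 𝓘(ℝ, F)) ∞ (fun x => TotalSpace.mk' F x (X x)) ∧
      ContMDiff I (I.prod 𝓘(ℝ, F₂)) ∞ (fun x => TotalSpace.mk' F₂ x (Y x)) := by
  refine ⟨fun h => ⟨fun x => ?_, fun x => ?_⟩, fun h x => ?_⟩
  · have h := (contMDiffAt_section (E := V ×ᵇ W) x).1 (h x)
    rw [contMDiffAt_section]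
    exact (contDiff_fst (𝕜 := ℝ) (E := F) (F := F₂) (n := ∞)).contMDiff.contMDiffAt.comp x h
  · have h := (contMDiffAt_section (E := V ×ᵇ W) x).1 (h x)
    rw [contMDiffAt_section]
    exact (contDiff_snd (𝕜 := ℝ) (E := F) (F := F₂) (n := ∞)).contMDiff.contMDiffAt.comp x h
  · have h1 := (contMDiffAt_section (E := V) x).1 (h.1 x)
    have h2 := (contMDiffAt_section (E := W) x).1 (h.2 x)
    rw [contMDiffAt_section]
    exact h1.prodMk_space h2

/-- The component in `Γ(V)` of a section of `V ⊕ V*`. -/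
def fst (e : Sec I (F × (F →L[ℝ] ℝ)) (V ×ᵇ Dual V)) : Sec I F V :=
  ⟨fun x => (e x).1, ((contMDiff_fst_snd (W := Dual V) _ _).1 e.contMDiff).1⟩

/-- The component in `Γ(V*)` of a section of `V ⊕ V*`. -/
def snd (e : Sec I (F × (F →L[ℝ] ℝ)) (V ×ᵇ Dual V)) : Sec I (F →L[ℝ] ℝ) (Dual V) :=
  ⟨fun x => (e x).2, ((contMDiff_fst_snd (V := V) (W := Dual V) _ _).1 e.contMDiff).2⟩

/-- The section `X + ξ` of `V ⊕ V*`. -/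
def pair (X : Sec I F V) (ξ : Sec I (F →L[ℝ] ℝ) (Dual V)) :
    Sec I (F × (F →L[ℝ] ℝ)) (V ×ᵇ Dual V) :=
  ⟨fun x => (X x, ξ x), (contMDiff_fst_snd (W := Dual V) _ _).2 ⟨X.contMDiff, ξ.contMDiff⟩⟩

/-- The form `(X₁ + ξ₁, X₂ + ξ₂)₊ = ½ (⟨ξ₁, X₂⟩ + ⟨ξ₂, X₁⟩)` on the fibre of `V ⊕ V*`. -/
def pairingPlus (x : P) : (V ×ᵇ Dual V) x →ₗ[ℝ] (V ×ᵇ Dual V) x →ₗ[ℝ] ℝ :=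
  LinearMap.mk₂ ℝ (fun u v => (1 / 2 : ℝ) * ((u.2 v.1 : ℝ) + (v.2 u.1 : ℝ)))
    (fun u v w => by
      change (1 / 2 : ℝ) * ((u.2 w.1 : ℝ) + (v.2 w.1 : ℝ) + (w.2 (u.1 + v.1) : ℝ)) = _
      rw [map_add]; ring)
    (fun c u v => by
      change (1 / 2 : ℝ) * (c * (u.2 v.1 : ℝ) + (v.2 (c • u.1) : ℝ)) = c * _
      rw [map_smul, smul_eq_mul]; ring)
    (fun u v w => by
      change (1 / 2 : ℝ) * ((u.2 (v.1 + w.1) : ℝ) + ((v.2 u.1 : ℝ) + (w.2 u.1 : ℝ))) = _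
      rw [map_add]; ring)
    (fun c u v => by
      change (1 / 2 : ℝ) * ((u.2 (c • v.1) : ℝ) + c * (v.2 u.1 : ℝ)) = c * _
      rw [map_smul, smul_eq_mul]; ring)

/-- The function `(e₁, e₂)₋ = ½ (⟨ξ₁, X₂⟩ - ⟨ξ₂, X₁⟩)` for sections `eᵢ = Xᵢ + ξᵢ` of `V ⊕ V*`. -/
def pairingMinus (e₁ e₂ : Sec I (F × (F →L[ℝ] ℝ)) (V ×ᵇ Dual V)) : Fn I P :=
  (1 / 2 : ℝ) • (pairing (snd e₁) (fst e₂) - pairing (snd e₂) (fst e₁))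

/-- The bracket of the sections `e₁ = X₁ + ξ₁` and `e₂ = X₂ + ξ₂` of `V ⊕ V*`:
`([X₁, X₂] + L_{ξ₁} X₂ - L_{ξ₂} X₁ - d_* (e₁, e₂)₋)
  + ([ξ₁, ξ₂] + L_{X₁} ξ₂ - L_{X₂} ξ₁ + d (e₁, e₂)₋)`. -/
def doubleBracket (L : LieAlgebroid I F V) (L' : LieAlgebroid I (F →L[ℝ] ℝ) (Dual V))
    (e₁ e₂ : Sec I (F × (F →L[ℝ] ℝ)) (V ×ᵇ Dual V)) :
    Sec I (F × (F →L[ℝ] ℝ)) (V ×ᵇ Dual V) :=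
  pair
    (L.bracket (fst e₁) (fst e₂) + L'.lieDerivStar (snd e₁) (fst e₂)
      - L'.lieDerivStar (snd e₂) (fst e₁) - L'.dStar₀ (pairingMinus e₁ e₂))
    (L'.bracket (snd e₁) (snd e₂) + L.lieDeriv (fst e₁) (snd e₂)
      - L.lieDeriv (fst e₂) (snd e₁) + L.d₀ (pairingMinus e₁ e₂))

/-- The bundle map `ρ(X + ξ) = a(X) + a_*(ξ)`. -/
def doubleAnchor (L : LieAlgebroid I F V) (L' : LieAlgebroid I (F →L[ℝ] ℝ) (Dual V)) :
    Anchor I (F × (F →L[ℝ] ℝ)) (V ×ᵇ Dual V) where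
  toFun x :=
    { toFun := fun u => L.anchor.toFun x u.1 + L'.anchor.toFun x u.2
      map_add' := fun u v => by
        change L.anchor.toFun x (u.1 + v.1) + L'.anchor.toFun x (u.2 + v.2) = _
        rw [map_add, map_add]; abel
      map_smul' := fun c u => by
        change L.anchor.toFun x (c • u.1) + L'.anchor.toFun x (c • u.2) = _
        rw [map_smul, map_smul, RingHom.id_apply, smul_add] }
  smooth e := (L.anchor.map (fst e) + L'.anchor.map (snd e)).contMDiff

end Frames
end Geometry
end Algebroid
end

/-!
The proof uses the Dorfman bracket `e₁ ∘ e₂ = [e₁, e₂] + 𝒟(e₁, e₂)₊` on `Γ(V ⊕ V*)`, where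
`𝒟 f = d_* f + d f`. It is not skew-symmetric, but it is a derivation of the form,
`ρ(e)(h₁, h₂)₊ = (e ∘ h₁, h₂)₊ + (h₁, e ∘ h₂)₊`, and its symmetric part is `𝒟(e₁, e₂)₊`. Both facts
are read off from the explicit formula `doubleForm_dorfman` for `2 (e₁ ∘ e₂, e₃)₊`.

The compatibility condition of a Lie bialgebroid enters in three low degrees only. For two functions
it says that `ρ ∘ 𝒟 = 0` (`IsLieBialgebroid.act_d₀_add`); for a section and a function, together
with the first case, it says that `ρ(e₁ ∘ e₂) = [ρ e₁, ρ e₂]`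
(`IsLieBialgebroid.pairing_bracket_dStar₀`); for two sections it is `IsLieBialgebroid.d_bracket`.
Vector fields are handled through their action on functions (`deriv_vectorFieldBracket`,
`tangentVector_eq_zero`).

The invariance of the form, the symmetric part of the bracket and the two statements about `ρ`,
collected in `IsPreDorfman`, imply that
`(e₁ ∘ (e₂ ∘ e₃) - (e₁ ∘ e₂) ∘ e₃ - e₂ ∘ (e₁ ∘ e₃), e₄)₊` is alternating in all four arguments. By
additivity it then has to vanish only for arguments from `Γ(V)` and `Γ(V*)` listed in a convenient
order (`IsPreDorfman.leibnizator_eq_zero`). With three arguments from `Γ(V)` or three from `Γ(V*)`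
this is the Jacobi identity of one of the two Lie algebroids; for `X, Y, ξ, η` it is the
compatibility condition for `X` and `Y` (`IsLieBialgebroid.doubleForm_leibnizator`). In particular
the self-duality of the notion of a Lie bialgebroid is not needed, as it is contained in the
alternation. Finally `IsPreDorfman.three_nsmul_cyclic_sum` turns the Leibniz identity of the Dorfman
bracket into the Jacobi identity up to `𝒟 T` of its skew-symmetric part.
-/

noncomputable section

namespace Algebroid

/-! ### Vector fields as derivations of the ring of smooth functions -/

section VectorFields

variable {EP : Type*} [NormedAddCommGroup EP] [NormedSpace ℝ EP] [FiniteDimensional ℝ EP]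
  {HP : Type*} [TopologicalSpace HP] {I : ModelWithCorners ℝ EP HP}
  {P : Type*} [TopologicalSpace P] [ChartedSpace HP P] [IsManifold I ∞ P]

/-- The Lie bracket of smooth vector fields, as a smooth vector field. -/
def vectorFieldBracket (U W : Sec I EP (TangentSpace I : P → Type _)) :
    Sec I EP (TangentSpace I : P → Type _) :=
  ⟨fun x => VectorField.mlieBracket I U W x, by
    have : IsManifold I (minSmoothness ℝ 2) P := by
      rw [minSmoothness_of_isRCLikeNormedField]
      exact IsManifold.of_le (n := ∞) (WithTop.coe_le_coe.2 (le_top (a := (2 : ℕ∞))))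
    have : IsManifold I (((⊤ : ℕ∞) : WithTop ℕ∞) + 1) P := by
      simpa using (inferInstance : IsManifold I ∞ P)
    have : CompleteSpace EP := FiniteDimensional.complete ℝ EP
    exact ContDiff.mlieBracket_vectorField (m := ⊤) (n := ⊤) U.contMDiff W.contMDiff
      (by rw [minSmoothness_of_isRCLikeNormedField]; simp)⟩

theorem vectorFieldBracket_smul (U W : Sec I EP (TangentSpace I : P → Type _)) (f : Fn I P) :
    vectorFieldBracket U (f • W) = deriv U f • W + f • vectorFieldBracket U W := by
  have : IsManifold I 2 P :=
    IsManifold.of_le (n := ∞) (WithTop.coe_le_coe.2 (le_top (a := (2 : ℕ∞))))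
  have : CompleteSpace EP := FiniteDimensional.complete ℝ EP
  ext x
  exact VectorField.mlieBracket_smul_right ((f.contMDiff x).mdifferentiableAt (by simp))
    ((W.contMDiff x).mdifferentiableAt (by simp))

theorem vectorFieldBracket_add (U W W' : Sec I EP (TangentSpace I : P → Type _)) :
    vectorFieldBracket U (W + W') = vectorFieldBracket U W + vectorFieldBracket U W' := by
  have : IsManifold I 2 P :=
    IsManifold.of_le (n := ∞) (WithTop.coe_le_coe.2 (le_top (a := (2 : ℕ∞))))
  have : CompleteSpace EP := FiniteDimensional.complete ℝ EP
  ext x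
  exact VectorField.mlieBracket_add_right ((W.contMDiff x).mdifferentiableAt (by simp))
    ((W'.contMDiff x).mdifferentiableAt (by simp))

theorem vectorFieldBracket_jacobi (U W Z : Sec I EP (TangentSpace I : P → Type _)) :
    vectorFieldBracket U (vectorFieldBracket W Z)
      = vectorFieldBracket (vectorFieldBracket U W) Z
        + vectorFieldBracket W (vectorFieldBracket U Z) := by
  have : IsManifold I (minSmoothness ℝ 3) P := by
    rw [minSmoothness_of_isRCLikeNormedField]
    exact IsManifold.of_le (n := ∞) (WithTop.coe_le_coe.2 (le_top (a := (3 : ℕ∞))))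
  have : CompleteSpace EP := FiniteDimensional.complete ℝ EP
  have h : ∀ T : Sec I EP (TangentSpace I : P → Type _),
      ContMDiff I I.tangent (minSmoothness ℝ 2) (fun x => (⟨x, T x⟩ : TangentBundle I P)) :=
    fun T => T.contMDiff.of_le (by
      rw [minSmoothness_of_isRCLikeNormedField]
      exact WithTop.coe_le_coe.2 (le_top (a := (2 : ℕ∞))))
  ext x
  exact congrFun (VectorField.leibniz_identity_mlieBracket (h U) (h W) (h Z)) x

/-- The Lie bracket of vector fields acts on functions as a commutator. This follows from the
Jacobi identity for `U`, `W`, `f • Z`, in which the coefficients of a nonvanishing `Z` are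
compared. -/
theorem deriv_vectorFieldBracket [T2Space P] (U W : Sec I EP (TangentSpace I : P → Type _))
    (f : Fn I P) :
    deriv (vectorFieldBracket U W) f = deriv U (deriv W f) - deriv W (deriv U f) := by
  ext x
  -- a nonvanishing vector field exists in positive dimension only
  rcases subsingleton_or_nontrivial EP with hEP | hEP
  · have h0 : ∀ (T : Sec I EP (TangentSpace I : P → Type _)) (g : Fn I P), deriv T g x = 0 := by
      intro T g
      have hT : T x = 0 := hEP.elim (α := EP) _ _
      change mfderiv I 𝓘(ℝ, ℝ) g x (T x) = 0
      rw [hT, map_zero]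
    change _ = deriv U (deriv W f) x - deriv W (deriv U f) x
    simp only [h0, sub_zero]
  obtain ⟨v, hv⟩ := exists_ne (0 : EP)
  obtain ⟨Z, hZ⟩ := exists_sec_eq (I := I) (F := EP) (V := (TangentSpace I : P → Type _)) x v
  have key : (deriv U (deriv W f) - deriv W (deriv U f) - deriv (vectorFieldBracket U W) f) • Z
      = 0 := by
    have h := vectorFieldBracket_jacobi U W (f • Z)
    simp only [vectorFieldBracket_smul, vectorFieldBracket_add,
      vectorFieldBracket_jacobi U W Z] at h
    rw [← sub_eq_zero] at h
    rw [← h]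
    module
  have h1 := congrArg (fun T : Sec I EP (TangentSpace I : P → Type _) => T x) key
  have h2 : (deriv U (deriv W f) x - deriv W (deriv U f) x
      - deriv (vectorFieldBracket U W) f x) • v = (0 : EP) := by
    rw [← hZ]; exact h1
  have h3 := (smul_eq_zero.1 h2).resolve_right hv
  exact (sub_eq_zero.1 h3).symm

/-- A tangent vector that annihilates all smooth functions is zero: test it on the coordinates of
a chart, cut off by a bump function. -/
theorem tangentVector_eq_zero [T2Space P] (x : P) (v : TangentSpace I x)
    (h : ∀ f : Fn I P, mfderiv I 𝓘(ℝ, ℝ) f x v = 0) : v = 0 := by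
  have h1P : IsManifold I 1 P := IsManifold.of_le (n := ∞) (by simp)
  have hinj :=
    (isInvertible_mfderiv_extChartAt (I := I) (mem_extChartAt_source (I := I) x)).injective
  apply hinj
  rw [map_zero]
  let w : EP := mfderiv I 𝓘(ℝ, EP) (extChartAt I x) x v
  change w = 0
  rw [← Module.forall_dual_apply_eq_zero_iff ℝ]
  intro φ
  let ℓ : EP →L[ℝ] ℝ := LinearMap.toContinuousLinearMap φ
  obtain ⟨χ⟩ : Nonempty (SmoothBumpFunction I x) := inferInstance
  have hg : ContMDiffOn I 𝓘(ℝ, ℝ) ∞ (fun y => ℓ (extChartAt I x y)) (chartAt HP x).source :=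
    ℓ.contMDiff.comp_contMDiffOn contMDiffOn_extChartAt
  have h1 := h ⟨fun y => χ y • ℓ (extChartAt I x y), χ.contMDiff_smul hg⟩
  have h2 : (fun y => χ y • ℓ (extChartAt I x y)) =ᶠ[𝓝 x] ℓ ∘ extChartAt I x := by
    filter_upwards [χ.eventuallyEq_one] with y hy
    simp [hy]
  have hd : MDifferentiableAt I 𝓘(ℝ, EP) (extChartAt I x) x :=
    mdifferentiableAt_extChartAt (mem_chart_source HP x)
  have h3 : mfderiv I 𝓘(ℝ, ℝ) (fun y => χ y • ℓ (extChartAt I x y)) x v = ℓ w := by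
    rw [h2.mfderiv_eq, mfderiv_comp x ℓ.mdifferentiableAt hd, ContinuousLinearMap.mfderiv_eq]
    rfl
  exact h3.symm.trans h1

end VectorFields

/-! ### Dorfman brackets -/

/-- The part of the axioms of a Courant algebroid, written for the Dorfman bracket
`e₁ ∘ e₂ = [e₁, e₂] + 𝒟(e₁, e₂)`, that does not involve three sections at a time. The normalization
is `(D f, e) = act e f` and `e₁ ∘ e₂ + e₂ ∘ e₁ = D (e₁, e₂)`: either `form` is twice the form of the
Courant algebroid and `D` is `𝒟`, or `form` is the form itself and `D` is `2 𝒟`. Only the additive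
structure of functions and sections plays a role. -/
structure IsPreDorfman {R E : Type*} [AddCommGroup R] [AddCommGroup E] (form : E → E → R)
    (dorf : E → E → E) (D : R → E) (act : E → R → R) : Prop where
  form_add_left : ∀ a b c, form (a + b) c = form a c + form b c
  form_symm : ∀ a b, form a b = form b a
  nondegenerate : ∀ a, (∀ b, form a b = 0) → a = 0
  dorf_add_left : ∀ a b c, dorf (a + b) c = dorf a c + dorf b c
  dorf_add_right : ∀ a b c, dorf a (b + c) = dorf a b + dorf a c
  D_add : ∀ f g, D (f + g) = D f + D g
  act_add : ∀ a f g, act a (f + g) = act a f + act a g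
  form_D : ∀ f a, form (D f) a = act a f
  dorf_symm : ∀ a b, dorf a b + dorf b a = D (form a b)
  act_form : ∀ a b c, act a (form b c) = form (dorf a b) c + form b (dorf a c)
  act_dorf : ∀ a b f, act (dorf a b) f = act a (act b f) - act b (act a f)
  act_D : ∀ f g, act (D f) g = 0

/-- The defect `e₁ ∘ (e₂ ∘ e₃) - (e₁ ∘ e₂) ∘ e₃ - e₂ ∘ (e₁ ∘ e₃)` of the Leibniz identity. -/
def leibnizator {E : Type*} [AddCommGroup E] (dorf : E → E → E) (a b c : E) : E :=
  dorf a (dorf b c) - dorf (dorf a b) c - dorf b (dorf a c)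

namespace IsPreDorfman

variable {R E : Type*} [AddCommGroup R] [AddCommGroup E] {form : E → E → R} {dorf : E → E → E}
  {D : R → E} {act : E → R → R}

theorem form_sub_left (h : IsPreDorfman form dorf D act) (a b c : E) :
    form (a - b) c = form a c - form b c :=
  (AddMonoidHom.mk' (fun a => form a c) fun a b => h.form_add_left a b c).map_sub a b

theorem form_neg_left (h : IsPreDorfman form dorf D act) (a c : E) :
    form (-a) c = -form a c :=
  (AddMonoidHom.mk' (fun a => form a c) fun a b => h.form_add_left a b c).map_neg a

theorem form_zero_left (h : IsPreDorfman form dorf D act) (c : E) : form 0 c = 0 :=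
  (AddMonoidHom.mk' (fun a => form a c) fun a b => h.form_add_left a b c).map_zero

theorem D_sub (h : IsPreDorfman form dorf D act) (f g : R) : D (f - g) = D f - D g :=
  (AddMonoidHom.mk' D h.D_add).map_sub f g

theorem act_sub (h : IsPreDorfman form dorf D act) (a : E) (f g : R) :
    act a (f - g) = act a f - act a g :=
  (AddMonoidHom.mk' (act a) (h.act_add a)).map_sub f g

theorem ext_form (h : IsPreDorfman form dorf D act) {a b : E} (hab : ∀ c, form a c = form b c) :
    a = b := by
  rw [← sub_eq_zero]
  exact h.nondegenerate _ fun c => by rw [h.form_sub_left, hab, sub_self]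

theorem dorf_D (h : IsPreDorfman form dorf D act) (a : E) (f : R) : dorf a (D f) = D (act a f) := by
  refine h.ext_form fun c => ?_
  have h1 := h.act_form a (D f) c
  rw [h.form_D, h.form_D, h.act_dorf] at h1
  rw [h.form_D, ← sub_eq_iff_eq_add.2 h1, sub_sub_cancel]

theorem D_dorf (h : IsPreDorfman form dorf D act) (f : R) (a : E) : dorf (D f) a = 0 := by
  have h1 := h.dorf_symm (D f) a
  rwa [h.dorf_D, h.form_D, add_eq_right] at h1

theorem leibnizator_add_left (h : IsPreDorfman form dorf D act) (a a' b c : E) :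
    leibnizator dorf (a + a') b c = leibnizator dorf a b c + leibnizator dorf a' b c := by
  simp only [leibnizator, h.dorf_add_left, h.dorf_add_right]
  abel

/-- `a ∘ b + b ∘ a = D (a, b)`, and `D f ∘ c = 0`. -/
theorem leibnizator_swap_left (h : IsPreDorfman form dorf D act) (a b c : E) :
    leibnizator dorf a b c = -leibnizator dorf b a c := by
  have h1 : dorf (dorf a b) c + dorf (dorf b a) c = 0 := by
    rw [← h.dorf_add_left, h.dorf_symm, h.D_dorf]
  rw [eq_neg_iff_add_eq_zero, ← neg_eq_zero, ← h1, leibnizator, leibnizator]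
  abel

/-- The difference of the two sides is `a ∘ D (b, c) - D (a ∘ b, c) - D (b, a ∘ c)`, which vanishes
since the Dorfman bracket preserves the form. -/
theorem leibnizator_swap_right (h : IsPreDorfman form dorf D act) (a b c : E) :
    leibnizator dorf a b c = -leibnizator dorf a c b := by
  have h1 : dorf a (dorf b c) + dorf a (dorf c b)
      = (dorf (dorf a b) c + dorf c (dorf a b)) + (dorf (dorf a c) b + dorf b (dorf a c)) := by
    rw [← h.dorf_add_right, h.dorf_symm, h.dorf_D, h.act_form, h.D_add, h.dorf_symm, h.dorf_symm,
      h.form_symm b]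
  rw [eq_neg_iff_add_eq_zero, ← sub_eq_zero.2 h1, leibnizator, leibnizator]
  abel

/-- `leibnizator dorf a b` is skew-adjoint, because `dorf a`, `dorf b` and
`dorf (dorf a b)` preserve the form and `act` is compatible with the bracket. -/
theorem form_leibnizator_swap (h : IsPreDorfman form dorf D act) (a b c d : E) :
    form (leibnizator dorf a b c) d = -form (leibnizator dorf a b d) c := by
  have e : ∀ a b c : E, form (dorf a b) c = act a (form b c) - form b (dorf a c) := fun a b c => by
    rw [h.act_form, add_sub_cancel_right]
  have e₂ : ∀ a b : E, form (dorf a (dorf b c)) d = act a (act b (form c d))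
      - act a (form c (dorf b d)) - act b (form c (dorf a d)) + form c (dorf b (dorf a d)) := by
    intro a b
    rw [e a (dorf b c) d, e b c d, e b c (dorf a d), h.act_sub]
    abel
  rw [h.form_symm _ c]
  have e₃ : form c (leibnizator dorf a b d)
      = form c (dorf a (dorf b d)) - form c (dorf (dorf a b) d) - form c (dorf b (dorf a d)) := by
    simp only [h.form_symm c, leibnizator, h.form_sub_left]
  rw [e₃, leibnizator, h.form_sub_left, h.form_sub_left, e₂ a b, e₂ b a, e (dorf a b) c d,
    h.act_dorf]
  abel

/-- If all sections are sums of elements of `S` and `T`, then the Leibniz identity for three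
sections from `S`, for three sections from `T`, and a part of it for two sections from `S` and two
sections from `T` imply the Leibniz identity in general, since `(leibnizator a b c, d)` is additive
and alternating in its four arguments. -/
theorem leibnizator_eq_zero (h : IsPreDorfman form dorf D act) {S T : Set E}
    (hadd : ∀ a, ∃ s ∈ S, ∃ t ∈ T, a = s + t)
    (hS : ∀ a ∈ S, ∀ b ∈ S, ∀ c ∈ S, leibnizator dorf a b c = 0)
    (hT : ∀ a ∈ T, ∀ b ∈ T, ∀ c ∈ T, leibnizator dorf a b c = 0)
    (hST : ∀ a ∈ S, ∀ b ∈ S, ∀ c ∈ T, ∀ d ∈ T, form (leibnizator dorf a b c) d = 0)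
    (a b c : E) : leibnizator dorf a b c = 0 := by
  let J : E → E → E → E → R := fun a b c d => form (leibnizator dorf a b c) d
  have s12 : ∀ a b c d, J a b c d = -J b a c d := fun a b c d => by
    simp only [J]; rw [h.leibnizator_swap_left, h.form_neg_left]
  have s23 : ∀ a b c d, J a b c d = -J a c b d := fun a b c d => by
    simp only [J]; rw [h.leibnizator_swap_right, h.form_neg_left]
  have s34 : ∀ a b c d, J a b c d = -J a b d c := fun a b c d => h.form_leibnizator_swap a b c d
  have add1 : ∀ a a' b c d, J (a + a') b c d = J a b c d + J a' b c d := fun a a' b c d => by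
    simp only [J]; rw [h.leibnizator_add_left, h.form_add_left]
  have SSS : ∀ a ∈ S, ∀ b ∈ S, ∀ c ∈ S, ∀ d, J a b c d = 0 := fun a ha b hb c hc d => by
    simp only [J]; rw [hS a ha b hb c hc, h.form_zero_left]
  have TTT : ∀ a ∈ T, ∀ b ∈ T, ∀ c ∈ T, ∀ d, J a b c d = 0 := fun a ha b hb c hc d => by
    simp only [J]; rw [hT a ha b hb c hc, h.form_zero_left]
  have SSTT : ∀ a ∈ S, ∀ b ∈ S, ∀ c ∈ T, ∀ d ∈ T, J a b c d = 0 := hST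
  have U4 : ∀ a ∈ S ∪ T, ∀ b ∈ S ∪ T, ∀ c ∈ S ∪ T, ∀ d ∈ S ∪ T, J a b c d = 0 := by
    rintro a (ha | ha) b (hb | hb) c (hc | hc) d (hd | hd)
    · exact SSS a ha b hb c hc d
    · exact SSS a ha b hb c hc d
    · rw [s34, SSS a ha b hb d hd, neg_zero]
    · exact SSTT a ha b hb c hc d hd
    · rw [s23, s34, SSS a ha c hc d hd, neg_zero, neg_zero]
    · rw [s23, SSTT a ha c hc b hb d hd, neg_zero]
    · rw [s34, s23, SSTT a ha d hd b hb c hc, neg_zero, neg_zero]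
    · rw [s12, s23, s34, TTT b hb c hc d hd, neg_zero, neg_zero, neg_zero]
    · rw [s12, s23, s34, SSS b hb c hc d hd, neg_zero, neg_zero, neg_zero]
    · rw [s12, s23, SSTT b hb c hc a ha d hd, neg_zero, neg_zero]
    · rw [s12, s34, s23, SSTT b hb d hd a ha c hc, neg_zero, neg_zero, neg_zero]
    · rw [s23, s34, TTT a ha c hc d hd, neg_zero, neg_zero]
    · rw [s23, s12, s34, s23, SSTT c hc d hd a ha b hb, neg_zero, neg_zero, neg_zero, neg_zero]
    · rw [s34, TTT a ha b hb d hd, neg_zero]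
    · exact TTT a ha b hb c hc d
    · exact TTT a ha b hb c hc d
  -- additivity extends the vanishing to arbitrary arguments, one at a time
  have red : ∀ b c d, (∀ u ∈ S ∪ T, J u b c d = 0) → ∀ a, J a b c d = 0 := by
    intro b c d hu a
    obtain ⟨s, hs, t, ht, rfl⟩ := hadd a
    rw [add1, hu s (Or.inl hs), hu t (Or.inr ht), add_zero]
  have U3 : ∀ b ∈ S ∪ T, ∀ c ∈ S ∪ T, ∀ d ∈ S ∪ T, ∀ a, J a b c d = 0 := fun b hb c hc d hd =>
    red b c d fun u hu => U4 u hu b hb c hc d hd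
  have U2 : ∀ c ∈ S ∪ T, ∀ d ∈ S ∪ T, ∀ a b, J b a c d = 0 := fun c hc d hd a =>
    red a c d fun u hu => by rw [s12, U3 u hu c hc d hd, neg_zero]
  have U1 : ∀ d ∈ S ∪ T, ∀ a b c, J c a b d = 0 := fun d hd a b =>
    red a b d fun u hu => by rw [s12, s23, U2 u hu d hd, neg_zero, neg_zero]
  exact h.nondegenerate _ fun d => by
    have := red a b c (fun u hu => by rw [s12, s23, s34, U1 u hu, neg_zero, neg_zero, neg_zero]) d
    rw [s12, s23, s34, neg_neg, neg_eq_zero] at this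
    exact this

/-- The cyclic sum of `(e₁ ∘ e₂) ∘ e₃`, when the Leibniz identity holds. Summing that identity
cyclically, exchanging the factors in `e₁ ∘ (e₂ ∘ e₃)` at the expense of `D (e₁, e₂ ∘ e₃)` and using
`(e₂ ∘ e₁) ∘ e₃ = -(e₁ ∘ e₂) ∘ e₃` gives three times the sum. -/
theorem three_nsmul_cyclic_sum (h : IsPreDorfman form dorf D act)
    (hJ : ∀ a b c, leibnizator dorf a b c = 0) (a b c : E) :
    3 • (dorf (dorf a b) c + dorf (dorf b c) a + dorf (dorf c a) b)
      = D (form a (dorf b c) - form b (dorf a c) + (form b (dorf c a) - form c (dorf b a))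
        + (form c (dorf a b) - form a (dorf c b))) := by
  have h1 : ∀ a b c, dorf (dorf a b) c = dorf a (dorf b c) - dorf b (dorf a c) := fun a b c => by
    have := hJ a b c
    rw [leibnizator, sub_right_comm] at this
    exact (sub_eq_zero.1 this).symm
  have h2 : ∀ a b c, dorf (dorf b a) c = -dorf (dorf a b) c := fun a b c => by
    rw [eq_neg_iff_add_eq_zero, ← h.dorf_add_left, h.dorf_symm, h.D_dorf]
  have h3 : ∀ a b c, D (form a (dorf b c)) = dorf a (dorf b c) + dorf (dorf b c) a :=
    fun a b c => (h.dorf_symm _ _).symm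
  simp only [h.D_add, h.D_sub, h3]
  rw [h2 c a b, h2 b c a, h2 a b c]
  rw [h1 a b c, h1 b c a, h1 c a b]
  abel

end IsPreDorfman

/-! ### Koszul's formula in low degrees -/

section LowDegree

variable {R M : Type*} [CommRing R] [AddCommGroup M] [Module R M]

theorem koszul_zero_apply (a : M → R → R) (br : M → M → M) (φ : M [⋀^Fin 0]→ₗ[R] R)
    (X : Fin 1 → M) : koszul a br φ X = a (X 0) (φ ![]) := by
  have h : (0 : Fin 1).removeNth X = ![] := Subsingleton.elim _ _
  simp only [koszul, Finset.sum_filter, Fin.sum_univ_succ, Finset.univ_eq_empty, Finset.sum_empty,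
    lt_irrefl, if_false, h]
  simp

theorem koszul_one_apply (a : M → R → R) (br : M → M → M) (φ : M [⋀^Fin 1]→ₗ[R] R)
    (X : Fin 2 → M) : koszul a br φ X
      = a (X 0) (φ ![X 1]) - a (X 1) (φ ![X 0]) - φ ![br (X 0) (X 1)] := by
  have h0 : (0 : Fin 2).removeNth X = ![X 1] := by ext i; fin_cases i; rfl
  have h1 : (1 : Fin 2).removeNth X = ![X 0] := by ext i; fin_cases i; rfl
  have h2 : (0 : Fin 2).removeNth (Function.update X 1 (br (X 0) (X 1))) = ![br (X 0) (X 1)] := by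
    ext i; fin_cases i; rfl
  simp only [koszul, Finset.sum_filter]
  rw [Fin.sum_univ_two, Fin.sum_univ_two, Fin.sum_univ_two, h0, h1, h2]
  simp
  abel

theorem sum_perm_fin_two {G : Type*} [AddCommMonoid G] (f : Equiv.Perm (Fin 2) → G) :
    ∑ σ, f σ = f 1 + f (Equiv.swap 0 1) := by
  have h : (Finset.univ : Finset (Equiv.Perm (Fin 2))) = {1, Equiv.swap 0 1} := by decide
  rw [h, Finset.sum_pair (by decide)]

end LowDegree

section Geometry

variable {EP : Type*} [NormedAddCommGroup EP] [NormedSpace ℝ EP] [FiniteDimensional ℝ EP]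
  {HP : Type*} [TopologicalSpace HP] {I : ModelWithCorners ℝ EP HP}
  {P : Type*} [TopologicalSpace P] [ChartedSpace HP P] [IsManifold I ∞ P] [T2Space P]
  {F : Type*} [NormedAddCommGroup F] [NormedSpace ℝ F] [FiniteDimensional ℝ F]
  {V : P → Type*} [∀ x, AddCommGroup (V x)] [∀ x, Module ℝ (V x)] [∀ x, TopologicalSpace (V x)]
  [∀ x, IsTopologicalAddGroup (V x)] [∀ x, ContinuousSMul ℝ (V x)]
  [TopologicalSpace (TotalSpace F V)] [FiberBundle F V] [VectorBundle ℝ F V]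
  [ContMDiffVectorBundle ∞ F V I]

/-! ### Pairings -/

theorem pairing_neg (ξ : Sec I (F →L[ℝ] ℝ) (Dual V)) (X : Sec I F V) :
    pairing ξ (-X) = -pairing ξ X := by
  ext x; exact (ξ x).map_neg (X x)

theorem pairing_zero (ξ : Sec I (F →L[ℝ] ℝ) (Dual V)) : pairing ξ (0 : Sec I F V) = 0 := by
  ext x; exact (ξ x).map_zero

theorem pairing_sub_left (ξ η : Sec I (F →L[ℝ] ℝ) (Dual V)) (X : Sec I F V) :
    pairing (ξ - η) X = pairing ξ X - pairing η X := rfl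

theorem pairing_neg_left (ξ : Sec I (F →L[ℝ] ℝ) (Dual V)) (X : Sec I F V) :
    pairing (-ξ) X = -pairing ξ X := rfl

theorem pairing_zero_left (X : Sec I F V) :
    pairing (0 : Sec I (F →L[ℝ] ℝ) (Dual V)) X = 0 := rfl

theorem ext_of_pairing_left {ξ η : Sec I (F →L[ℝ] ℝ) (Dual V)}
    (h : ∀ X : Sec I F V, pairing ξ X = pairing η X) : ξ = η := by
  let φ : Sec I F V →ₗ[Fn I P] Fn I P :=
    { toFun := fun X => pairing η X
      map_add' := pairing_add η
      map_smul' := pairing_smul η }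
  exact (exists_dual_sec φ).unique (y₁ := ξ) (y₂ := η) h (fun _ => rfl)

namespace LieAlgebroid

theorem pairing_d₀ (L : LieAlgebroid I F V) (f : Fn I P) (X : Sec I F V) :
    pairing (L.d₀ f) X = L.anchor.act X f := pairing_ofDual _ X

theorem pairing_lieDeriv (L : LieAlgebroid I F V) (X : Sec I F V)
    (ξ : Sec I (F →L[ℝ] ℝ) (Dual V)) (Y : Sec I F V) :
    pairing (L.lieDeriv X ξ) Y = L.anchor.act X (pairing ξ Y) - pairing ξ (L.bracket X Y) :=
  pairing_ofDual _ Y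

theorem pairing_dStar₀ (L' : LieAlgebroid I (F →L[ℝ] ℝ) (Dual V)) (f : Fn I P)
    (ξ : Sec I (F →L[ℝ] ℝ) (Dual V)) : pairing ξ (L'.dStar₀ f) = L'.anchor.act ξ f :=
  pairing_ofBidual _ ξ

theorem pairing_lieDerivStar (L' : LieAlgebroid I (F →L[ℝ] ℝ) (Dual V))
    (ξ : Sec I (F →L[ℝ] ℝ) (Dual V)) (X : Sec I F V) (η : Sec I (F →L[ℝ] ℝ) (Dual V)) :
    pairing η (L'.lieDerivStar ξ X) = L'.anchor.act ξ (pairing η X) - pairing (L'.bracket ξ η) X :=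
  pairing_ofBidual _ η

theorem act_bracket (L : LieAlgebroid I F V) (X Y : Sec I F V) (f : Fn I P) :
    L.anchor.act (L.bracket X Y) f
      = L.anchor.act X (L.anchor.act Y f) - L.anchor.act Y (L.anchor.act X f) := by
  have h : L.anchor.map (L.bracket X Y)
      = vectorFieldBracket (L.anchor.map X) (L.anchor.map Y) := by
    ext x; exact L.anchor_bracket X Y x
  rw [Anchor.act, h, deriv_vectorFieldBracket]
  rfl

theorem d_zero_apply (L : LieAlgebroid I F V) (φ : Form I F V 0) (X : Fin 1 → Sec I F V) :
    L.d φ X = L.anchor.act (X 0) (φ ![]) := koszul_zero_apply _ _ φ X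

theorem d_one_apply (L : LieAlgebroid I F V) (φ : Form I F V 1) (X : Fin 2 → Sec I F V) :
    L.d φ X = L.anchor.act (X 0) (φ ![X 1]) - L.anchor.act (X 1) (φ ![X 0])
      - φ ![L.bracket (X 0) (X 1)] := koszul_one_apply _ _ φ X

end LieAlgebroid

/-! ### The compatibility conditions in low degrees -/

/-- A function as a multivector of degree `0`. -/
def zeroVec (f : Fn I P) : MultiVec I F V 0 := AlternatingMap.constOfIsEmpty _ _ _ f

/-- A section of `V` as a multivector of degree `1`. -/
def oneVec (X : Sec I F V) : MultiVec I F V 1 :=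
  AlternatingMap.ofSubsingleton _ _ _ (0 : Fin 1)
    { toFun := fun ξ => pairing ξ X
      map_add' := fun _ _ => rfl
      map_smul' := fun _ _ => rfl }

theorem zeroVec_apply (f : Fn I P) (ζ : Fin 0 → Sec I (F →L[ℝ] ℝ) (Dual V)) :
    zeroVec (F := F) (V := V) f ζ = f := rfl

theorem oneVec_apply (X : Sec I F V) (ζ : Fin 1 → Sec I (F →L[ℝ] ℝ) (Dual V)) :
    oneVec X ζ = pairing (ζ 0) X := rfl

theorem sharp_oneVec (X : Sec I F V) (ζ : Fin 0 → Sec I (F →L[ℝ] ℝ) (Dual V)) :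
    sharp (a := 0) (oneVec X) ζ = X :=
  ext_of_pairing fun ξ => by rw [pairing_sharp]; rfl

theorem sharp_d_zeroVec (L' : LieAlgebroid I (F →L[ℝ] ℝ) (Dual V)) (f : Fn I P)
    (ζ : Fin 0 → Sec I (F →L[ℝ] ℝ) (Dual V)) :
    sharp (a := 0) (L'.d (zeroVec f)) ζ = L'.dStar₀ f :=
  ext_of_pairing fun ξ => by
    rw [pairing_sharp, AlternatingMap.curryLeft_apply_apply, L'.d_zero_apply, L'.pairing_dStar₀]
    rfl

/-- The contraction of `d_* X` with `ξ` in the second argument is `d_* ⟨ξ, X⟩ - L_ξ X`. -/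
theorem sharp_d_oneVec (L' : LieAlgebroid I (F →L[ℝ] ℝ) (Dual V)) (X : Sec I F V)
    (ζ : Fin 1 → Sec I (F →L[ℝ] ℝ) (Dual V)) :
    sharp (a := 1) (L'.d (oneVec X)) ζ
      = L'.dStar₀ (pairing (ζ 0) X) - L'.lieDerivStar (ζ 0) X :=
  ext_of_pairing fun ξ => by
    rw [pairing_sharp, AlternatingMap.curryLeft_apply_apply, L'.d_one_apply, pairing_sub,
      L'.pairing_dStar₀, L'.pairing_lieDerivStar, L'.skew]
    simp only [oneVec_apply, Matrix.cons_val_zero, Matrix.cons_val_one, pairing_neg_left]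
    ring

namespace IsLieBialgebroid

variable {L : LieAlgebroid I F V} {L' : LieAlgebroid I (F →L[ℝ] ℝ) (Dual V)}

/-- The compatibility condition for two functions. -/
theorem act_d₀_add (h : IsLieBialgebroid L L') (f g : Fn I P) :
    L'.anchor.act (L.d₀ g) f + L'.anchor.act (L.d₀ f) g = 0 := by
  have h1 := congrArg (fun Q : MultiVec I F V 0 => Q ![])
    (h.d_schouten_zero (zeroVec f) (zeroVec g))
  simp only [LieAlgebroid.schouten] at h1
  simp [LieAlgebroid.d_zero_apply, zeroVec_apply] at h1
  exact h1.symm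

/-- The compatibility condition for a section and a function. In the condition the differential
`d_* X` is evaluated on `d f` and `ξ`; the terms with `a(X) f` cancel. -/
theorem pairing_bracket_dStar₀ (h : IsLieBialgebroid L L') (X : Sec I F V) (f : Fn I P)
    (ξ : Sec I (F →L[ℝ] ℝ) (Dual V)) :
    pairing ξ (L.bracket X (L'.dStar₀ f))
      = L'.anchor.act (L.d₀ f) (pairing ξ X) + pairing (L'.bracket ξ (L.d₀ f)) X := by
  have h1 := congrArg (fun Q : MultiVec I F V 1 => Q ![ξ])
    (h.d_schouten (n := 0) (show 1 + 0 = 0 + 1 from rfl) (oneVec X) (zeroVec f))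
  simp only [LieAlgebroid.schouten, LieAlgebroid.schoutenPos] at h1
  simp [LieAlgebroid.d_zero_apply, LieAlgebroid.d_one_apply, zeroVec_apply, oneVec_apply,
    altSumForm, LieAlgebroid.schoutenTuple, LieAlgebroid.schoutenTerm, sharp_oneVec,
    sharp_d_zeroVec] at h1
  rw [L'.skew ξ, pairing_neg_left]
  linear_combination -h1

/-- The compatibility condition for two sections, evaluated on `ξ` and `η`. -/
theorem d_bracket (h : IsLieBialgebroid L L') (X Y : Sec I F V)
    (ξ η : Sec I (F →L[ℝ] ℝ) (Dual V)) :
    L'.anchor.act ξ (pairing η (L.bracket X Y)) - L'.anchor.act η (pairing ξ (L.bracket X Y))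
        - pairing (L'.bracket ξ η) (L.bracket X Y)
      = pairing ξ (L.bracket (L'.dStar₀ (pairing η X) - L'.lieDerivStar η X) Y)
        - pairing η (L.bracket (L'.dStar₀ (pairing ξ X) - L'.lieDerivStar ξ X) Y)
        + L.anchor.act Y (L'.anchor.act ξ (pairing η X) - L'.anchor.act η (pairing ξ X)
          - pairing (L'.bracket ξ η) X)
        + (pairing ξ (L.bracket X (L'.dStar₀ (pairing η Y) - L'.lieDerivStar η Y))
          - pairing η (L.bracket X (L'.dStar₀ (pairing ξ Y) - L'.lieDerivStar ξ Y))
          - L.anchor.act X (L'.anchor.act ξ (pairing η Y) - L'.anchor.act η (pairing ξ Y)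
            - pairing (L'.bracket ξ η) Y)) := by
  have h1 := congrArg (fun Q : MultiVec I F V 2 => Q ![ξ, η])
    (h.d_schouten (n := 1) (show 1 + 1 = 1 + 1 from rfl) (oneVec X) (oneVec Y))
  simp only [LieAlgebroid.schouten, LieAlgebroid.schoutenPos] at h1
  -- the Schouten brackets become sums over the two permutations of `ξ` and `η`
  simp [LieAlgebroid.d_one_apply, oneVec_apply, altSumForm, LieAlgebroid.schoutenTuple,
    LieAlgebroid.schoutenTerm, sharp_oneVec, sharp_d_oneVec] at h1
  rw [sum_perm_fin_two, sum_perm_fin_two] at h1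
  simp only [Equiv.Perm.sign_one, Equiv.Perm.sign_swap zero_ne_one, Equiv.Perm.one_apply,
    Equiv.swap_apply_left, Equiv.swap_apply_right, Matrix.cons_val_zero, Matrix.cons_val_one,
    L'.skew η ξ, pairing_neg_left, Anchor.act_sub, Anchor.act_neg, Units.val_one, Units.val_neg,
    Int.cast_one, Int.cast_neg, one_mul, neg_mul] at h1
  rw [h1]
  simp only [Anchor.act_sub]
  module

end IsLieBialgebroid

/-! ### Sections of `V ⊕ V*` -/

theorem fst_add (a b : Sec I (F × (F →L[ℝ] ℝ)) (V ×ᵇ Dual V)) : fst (a + b) = fst a + fst b := rfl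

theorem snd_add (a b : Sec I (F × (F →L[ℝ] ℝ)) (V ×ᵇ Dual V)) : snd (a + b) = snd a + snd b := rfl

theorem fst_pair (X : Sec I F V) (ξ : Sec I (F →L[ℝ] ℝ) (Dual V)) : fst (pair X ξ) = X := rfl

theorem snd_pair (X : Sec I F V) (ξ : Sec I (F →L[ℝ] ℝ) (Dual V)) : snd (pair X ξ) = ξ := rfl

theorem ext_fst_snd {a b : Sec I (F × (F →L[ℝ] ℝ)) (V ×ᵇ Dual V)} (h1 : fst a = fst b)
    (h2 : snd a = snd b) : a = b := by
  ext x : 1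
  exact Prod.ext (congrArg (fun X : Sec I F V => X x) h1)
    (congrArg (fun ξ : Sec I (F →L[ℝ] ℝ) (Dual V) => ξ x) h2)

/-- Twice the form `( , )₊`: the function `⟨ξ₁, X₂⟩ + ⟨ξ₂, X₁⟩`. -/
def doubleForm (a b : Sec I (F × (F →L[ℝ] ℝ)) (V ×ᵇ Dual V)) : Fn I P :=
  pairing (snd a) (fst b) + pairing (snd b) (fst a)

/-- The operator `𝒟 f = d_* f + d f`. -/
def doubleD (L : LieAlgebroid I F V) (L' : LieAlgebroid I (F →L[ℝ] ℝ) (Dual V)) (f : Fn I P) :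
    Sec I (F × (F →L[ℝ] ℝ)) (V ×ᵇ Dual V) :=
  pair (L'.dStar₀ f) (L.d₀ f)

/-- The Dorfman bracket of `X₁ + ξ₁` and `X₂ + ξ₂`:
`([X₁, X₂] + L_{ξ₁} X₂ - ι_{ξ₂} d_* X₁) + ([ξ₁, ξ₂] + L_{X₁} ξ₂ - ι_{X₂} d ξ₁)`, where
`ι_ξ d_* X = L_ξ X - d_* ⟨ξ, X⟩` and `ι_X d ξ = L_X ξ - d ⟨ξ, X⟩`. -/
def dorfman (L : LieAlgebroid I F V) (L' : LieAlgebroid I (F →L[ℝ] ℝ) (Dual V))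
    (a b : Sec I (F × (F →L[ℝ] ℝ)) (V ×ᵇ Dual V)) : Sec I (F × (F →L[ℝ] ℝ)) (V ×ᵇ Dual V) :=
  pair
    (L.bracket (fst a) (fst b) + L'.lieDerivStar (snd a) (fst b)
      + (L'.dStar₀ (pairing (snd b) (fst a)) - L'.lieDerivStar (snd b) (fst a)))
    (L'.bracket (snd a) (snd b) + L.lieDeriv (fst a) (snd b)
      + (L.d₀ (pairing (snd a) (fst b)) - L.lieDeriv (fst b) (snd a)))

theorem doubleAnchor_act (L : LieAlgebroid I F V) (L' : LieAlgebroid I (F →L[ℝ] ℝ) (Dual V))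
    (a : Sec I (F × (F →L[ℝ] ℝ)) (V ×ᵇ Dual V)) (f : Fn I P) :
    (doubleAnchor L L').act a f = L.anchor.act (fst a) f + L'.anchor.act (snd a) f := by
  ext x
  exact map_add (mfderiv I 𝓘(ℝ, ℝ) f x) _ _

theorem doubleForm_comm (a b : Sec I (F × (F →L[ℝ] ℝ)) (V ×ᵇ Dual V)) :
    doubleForm a b = doubleForm b a := add_comm _ _

theorem doubleForm_add (a b c : Sec I (F × (F →L[ℝ] ℝ)) (V ×ᵇ Dual V)) :
    doubleForm (a + b) c = doubleForm a c + doubleForm b c := by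
  simp only [doubleForm, fst_add, snd_add, pairing_add, pairing_add_left]
  ring

theorem doubleForm_zero (a : Sec I (F × (F →L[ℝ] ℝ)) (V ×ᵇ Dual V)) : doubleForm 0 a = 0 := by
  have h := doubleForm_add 0 0 a
  rwa [add_zero, left_eq_add] at h

theorem eq_of_doubleForm {a b : Sec I (F × (F →L[ℝ] ℝ)) (V ×ᵇ Dual V)}
    (h : ∀ c, doubleForm a c = doubleForm b c) : a = b := by
  refine ext_fst_snd (ext_of_pairing fun ξ => ?_) (ext_of_pairing_left fun X => ?_)
  · simpa only [doubleForm, fst_pair, snd_pair, pairing_zero, zero_add] using h (pair 0 ξ)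
  · simpa only [doubleForm, fst_pair, snd_pair, pairing_zero_left, add_zero] using h (pair X 0)

/-- The Dorfman bracket, paired with a third section. -/
theorem doubleForm_dorfman (L : LieAlgebroid I F V) (L' : LieAlgebroid I (F →L[ℝ] ℝ) (Dual V))
    (a b c : Sec I (F × (F →L[ℝ] ℝ)) (V ×ᵇ Dual V)) :
    doubleForm (dorfman L L' a b) c
      = pairing (snd c) (L.bracket (fst a) (fst b)) - pairing (snd b) (L.bracket (fst a) (fst c))
        + pairing (snd a) (L.bracket (fst b) (fst c))
        + pairing (L'.bracket (snd a) (snd b)) (fst c)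
        - pairing (L'.bracket (snd a) (snd c)) (fst b)
        + pairing (L'.bracket (snd b) (snd c)) (fst a)
        + L.anchor.act (fst a) (pairing (snd b) (fst c))
        - L.anchor.act (fst b) (pairing (snd a) (fst c))
        + L.anchor.act (fst c) (pairing (snd a) (fst b))
        + L'.anchor.act (snd a) (pairing (snd c) (fst b))
        - L'.anchor.act (snd b) (pairing (snd c) (fst a))
        + L'.anchor.act (snd c) (pairing (snd b) (fst a)) := by
  simp only [doubleForm, dorfman, fst_pair, snd_pair, pairing_add, pairing_sub, pairing_add_left,
    pairing_sub_left, L.pairing_lieDeriv, L.pairing_d₀, L'.pairing_lieDerivStar, L'.pairing_dStar₀]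
  ring

theorem act_sub_left (a : Anchor I F V) (X Y : Sec I F V) (f : Fn I P) :
    a.act (X - Y) f = a.act X f - a.act Y f :=
  eq_sub_of_add_eq (by rw [← a.act_add_left, sub_add_cancel])

theorem d₀_add (L : LieAlgebroid I F V) (f g : Fn I P) : L.d₀ (f + g) = L.d₀ f + L.d₀ g :=
  ext_of_pairing_left fun X => by
    simp only [pairing_add_left, L.pairing_d₀, Anchor.act_add]

theorem dStar₀_add (L' : LieAlgebroid I (F →L[ℝ] ℝ) (Dual V)) (f g : Fn I P) :
    L'.dStar₀ (f + g) = L'.dStar₀ f + L'.dStar₀ g :=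
  ext_of_pairing fun ξ => by
    simp only [pairing_add, L'.pairing_dStar₀, Anchor.act_add]

theorem doubleForm_doubleD (L : LieAlgebroid I F V) (L' : LieAlgebroid I (F →L[ℝ] ℝ) (Dual V))
    (f : Fn I P) (a : Sec I (F × (F →L[ℝ] ℝ)) (V ×ᵇ Dual V)) :
    doubleForm (doubleD L L' f) a = (doubleAnchor L L').act a f := by
  rw [doubleAnchor_act, doubleForm, doubleD, fst_pair, snd_pair, L.pairing_d₀, L'.pairing_dStar₀]

/-! ### The Dorfman bracket of a Lie bialgebroid -/

namespace IsLieBialgebroid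

variable {L : LieAlgebroid I F V} {L' : LieAlgebroid I (F →L[ℝ] ℝ) (Dual V)}

theorem act_dStar₀ (h : IsLieBialgebroid L L') (f g : Fn I P) :
    L.anchor.act (L'.dStar₀ f) g = -L'.anchor.act (L.d₀ f) g := by
  rw [← L.pairing_d₀, L'.pairing_dStar₀, eq_neg_iff_add_eq_zero]
  exact h.act_d₀_add f g

theorem act_lieDerivStar (L : LieAlgebroid I F V) (L' : LieAlgebroid I (F →L[ℝ] ℝ) (Dual V))
    (ξ : Sec I (F →L[ℝ] ℝ) (Dual V)) (X : Sec I F V) (f : Fn I P) :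
    L.anchor.act (L'.lieDerivStar ξ X) f
      = L'.anchor.act ξ (L.anchor.act X f) - pairing (L'.bracket ξ (L.d₀ f)) X := by
  rw [← L.pairing_d₀, L'.pairing_lieDerivStar, L.pairing_d₀]

theorem act_lieDeriv (h : IsLieBialgebroid L L') (X : Sec I F V)
    (ξ : Sec I (F →L[ℝ] ℝ) (Dual V)) (f : Fn I P) :
    L'.anchor.act (L.lieDeriv X ξ) f
      = L.anchor.act X (L'.anchor.act ξ f) - L'.anchor.act (L.d₀ f) (pairing ξ X)
        - pairing (L'.bracket ξ (L.d₀ f)) X := by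
  rw [← L'.pairing_dStar₀, L.pairing_lieDeriv, L'.pairing_dStar₀, h.pairing_bracket_dStar₀]
  ring

theorem isPreDorfman (h : IsLieBialgebroid L L') :
    IsPreDorfman doubleForm (dorfman L L') (doubleD L L') (doubleAnchor L L').act where
  form_add_left := doubleForm_add
  form_symm := doubleForm_comm
  nondegenerate a ha := eq_of_doubleForm fun c => by rw [ha c, doubleForm_zero]
  dorf_add_left a b c := eq_of_doubleForm fun d => by
    simp only [doubleForm_add, doubleForm_dorfman, fst_add, snd_add, pairing_add, pairing_add_left,
      L.add_bracket, L'.add_bracket, Anchor.act_add, Anchor.act_add_left]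
    ring
  dorf_add_right a b c := eq_of_doubleForm fun d => by
    simp only [doubleForm_add, doubleForm_dorfman, fst_add, snd_add, pairing_add, pairing_add_left,
      L.add_bracket, L'.add_bracket, L.bracket_add, L'.bracket_add, Anchor.act_add,
      Anchor.act_add_left]
    ring
  D_add f g := by
    simp only [doubleD, d₀_add, dStar₀_add]
    rfl
  act_add a := (doubleAnchor L L').act_add a
  form_D := doubleForm_doubleD L L'
  dorf_symm a b := eq_of_doubleForm fun c => by
    rw [doubleForm_add, doubleForm_dorfman, doubleForm_dorfman, doubleForm_doubleD,
      doubleAnchor_act, doubleForm, L.skew (fst b) (fst a), L'.skew (snd b) (snd a)]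
    simp only [Anchor.act_add, pairing_neg, pairing_neg_left]
    ring
  act_form a b c := by
    rw [doubleForm_comm b (dorfman L L' a c), doubleForm_dorfman, doubleForm_dorfman,
      doubleAnchor_act, doubleForm, L.skew (fst c) (fst b), L'.skew (snd c) (snd b)]
    simp only [Anchor.act_add, pairing_neg, pairing_neg_left]
    ring
  act_dorf a b f := by
    simp only [doubleAnchor_act, dorfman, fst_pair, snd_pair, Anchor.act_add_left, act_sub_left,
      Anchor.act_add, L.act_bracket, L'.act_bracket, act_lieDerivStar, h.act_lieDeriv,
      h.act_dStar₀]
    linear_combination h.act_d₀_add f (pairing (snd a) (fst b))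
      - h.act_d₀_add f (pairing (snd b) (fst a))
  act_D f g := by
    rw [doubleAnchor_act, doubleD, fst_pair, snd_pair, h.act_dStar₀, neg_add_cancel]

end IsLieBialgebroid

/-! ### The Leibniz identity -/

theorem act_zero_left (a : Anchor I F V) (f : Fn I P) : a.act 0 f = 0 := by
  have h := a.act_add_left 0 0 f
  rwa [add_zero, left_eq_add] at h

theorem zero_bracket (L : LieAlgebroid I F V) (X : Sec I F V) : L.bracket 0 X = 0 := by
  have h := L.add_bracket 0 0 X
  rwa [add_zero, left_eq_add] at h

theorem bracket_zero (L : LieAlgebroid I F V) (X : Sec I F V) : L.bracket X 0 = 0 := by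
  rw [L.skew, zero_bracket, neg_zero]

theorem dorfman_inl (L : LieAlgebroid I F V) (L' : LieAlgebroid I (F →L[ℝ] ℝ) (Dual V))
    (X : Sec I F V) (b : Sec I (F × (F →L[ℝ] ℝ)) (V ×ᵇ Dual V)) :
    dorfman L L' (pair X 0) b
      = pair (L.bracket X (fst b) + (L'.dStar₀ (pairing (snd b) X) - L'.lieDerivStar (snd b) X))
          (L.lieDeriv X (snd b)) :=
  eq_of_doubleForm fun c => by
    rw [doubleForm_dorfman]
    simp only [doubleForm, fst_pair, snd_pair, pairing_add, pairing_sub, L.pairing_lieDeriv,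
      L'.pairing_lieDerivStar, L'.pairing_dStar₀, zero_bracket, pairing_zero_left, Anchor.act_zero,
      act_zero_left]
    ring

theorem dorfman_inl_inl (L : LieAlgebroid I F V) (L' : LieAlgebroid I (F →L[ℝ] ℝ) (Dual V))
    (X Y : Sec I F V) : dorfman L L' (pair X 0) (pair Y 0) = pair (L.bracket X Y) 0 :=
  eq_of_doubleForm fun c => by
    rw [doubleForm_dorfman]
    simp only [doubleForm, fst_pair, snd_pair, zero_bracket, pairing_zero_left, Anchor.act_zero,
      act_zero_left]
    ring

theorem dorfman_inr_inr (L : LieAlgebroid I F V) (L' : LieAlgebroid I (F →L[ℝ] ℝ) (Dual V))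
    (ξ η : Sec I (F →L[ℝ] ℝ) (Dual V)) :
    dorfman L L' (pair 0 ξ) (pair 0 η) = pair 0 (L'.bracket ξ η) :=
  eq_of_doubleForm fun c => by
    rw [doubleForm_dorfman]
    simp only [doubleForm, fst_pair, snd_pair, zero_bracket, pairing_zero, Anchor.act_zero,
      act_zero_left]
    ring

/-- The Jacobi identity in Leibniz form. -/
theorem LieAlgebroid.bracket_bracket (L : LieAlgebroid I F V) (X Y Z : Sec I F V) :
    L.bracket X (L.bracket Y Z) = L.bracket (L.bracket X Y) Z + L.bracket Y (L.bracket X Z) := by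
  have h := L.jacobi X Y Z
  have h1 : L.bracket (-L.bracket X Z) Y = L.bracket Y (L.bracket X Z) := by
    rw [L.skew, ← sub_eq_zero, ← neg_add', ← L.bracket_add, neg_add_cancel, bracket_zero, neg_zero]
  rw [L.skew X (L.bracket Y Z), ← add_eq_zero_iff_neg_eq', ← h, L.skew Z X, h1]
  abel

namespace IsLieBialgebroid

variable {L : LieAlgebroid I F V} {L' : LieAlgebroid I (F →L[ℝ] ℝ) (Dual V)}

/-- The Leibniz identity for `X`, `Y`, `ξ`, paired with `η`, is the compatibility condition for
`X` and `Y`. -/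
theorem doubleForm_leibnizator (h : IsLieBialgebroid L L') (X Y : Sec I F V)
    (ξ η : Sec I (F →L[ℝ] ℝ) (Dual V)) :
    doubleForm (leibnizator (dorfman L L') (pair X 0) (pair Y 0) (pair 0 ξ)) (pair 0 η) = 0 := by
  have h0 := h.d_bracket X Y ξ η
  -- these turn `⟨ξ, [X, ι_η d_* Y]⟩` into a contraction with `L_X ξ`, and likewise for `Y` and `X`
  have h1 := L.pairing_lieDeriv X ξ (L'.dStar₀ (pairing η Y) - L'.lieDerivStar η Y)
  have h2 := L.pairing_lieDeriv Y ξ (L'.dStar₀ (pairing η X) - L'.lieDerivStar η X)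
  rw [leibnizator, h.isPreDorfman.form_sub_left, h.isPreDorfman.form_sub_left, dorfman_inl_inl]
  simp only [dorfman_inl, fst_pair, snd_pair, bracket_zero, zero_add, doubleForm, pairing_zero]
  rw [L.skew (_ - _) Y, L.skew (_ - _) Y, pairing_neg, pairing_neg] at h0
  simp only [pairing_add, pairing_sub, L'.pairing_dStar₀, L'.pairing_lieDerivStar,
    L'.skew η, pairing_neg_left, Anchor.act_sub, Anchor.act_neg] at h0 h1 h2 ⊢
  linear_combination h0 + h1 - h2

/-- The Leibniz identity for the Dorfman bracket of a Lie bialgebroid. -/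
theorem leibnizator_dorfman (h : IsLieBialgebroid L L')
    (a b c : Sec I (F × (F →L[ℝ] ℝ)) (V ×ᵇ Dual V)) : leibnizator (dorfman L L') a b c = 0 := by
  refine h.isPreDorfman.leibnizator_eq_zero (S := Set.range fun X => pair X 0)
    (T := Set.range fun ξ => pair 0 ξ) (fun a => ?_) ?_ ?_ ?_ a b c
  · exact ⟨_, ⟨fst a, rfl⟩, _, ⟨snd a, rfl⟩,
      ext_fst_snd (add_zero (fst a)).symm (zero_add (snd a)).symm⟩
  · rintro _ ⟨X, rfl⟩ _ ⟨Y, rfl⟩ _ ⟨Z, rfl⟩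
    simp only [leibnizator, dorfman_inl_inl]
    rw [L.bracket_bracket, sub_sub, sub_eq_zero]
    exact ext_fst_snd rfl (add_zero _).symm
  · rintro _ ⟨ξ, rfl⟩ _ ⟨η, rfl⟩ _ ⟨ζ, rfl⟩
    simp only [leibnizator, dorfman_inr_inr]
    rw [L'.bracket_bracket, sub_sub, sub_eq_zero]
    exact ext_fst_snd (add_zero _).symm rfl
  · rintro _ ⟨X, rfl⟩ _ ⟨Y, rfl⟩ _ ⟨ξ, rfl⟩ _ ⟨η, rfl⟩
    exact h.doubleForm_leibnizator X Y ξ η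

end IsLieBialgebroid

/-! ### The Courant algebroid -/

variable (I F V) in
/-- The form `( , )₊` on `V ⊕ V*`. -/
def doubleMetric : BundleForm I (F × (F →L[ℝ] ℝ)) (V ×ᵇ Dual V) where
  form := pairingPlus
  smooth a b := ((1 / 2 : ℝ) • doubleForm a b).contMDiff
  symm x u v := congrArg (fun t : ℝ => (1 / 2 : ℝ) * t) (add_comm (u.2 v.1 : ℝ) (v.2 u.1))
  nondegenerate x u hu := by
    have : FiniteDimensional ℝ (V x) := VectorBundle.finiteDimensional ℝ F V x
    have : T2Space (V x) :=
      (VectorBundle.continuousLinearEquivAt ℝ F V x).symm.toHomeomorph.t2Space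
    have h1 : ∀ v : (V ×ᵇ Dual V) x, (u.2 v.1 : ℝ) + (v.2 u.1 : ℝ) = 0 := fun v =>
      (mul_eq_zero.1 (hu v)).resolve_left (by norm_num)
    refine Prod.ext ?_ ?_
    · change u.1 = 0
      rw [← Module.forall_dual_apply_eq_zero_iff ℝ]
      intro φ
      have h2 := h1 (0, LinearMap.toContinuousLinearMap φ)
      rwa [map_zero, zero_add] at h2
    · ext v
      have h2 := h1 (v, 0)
      simpa using h2

theorem doubleMetric_fn (a b : Sec I (F × (F →L[ℝ] ℝ)) (V ×ᵇ Dual V)) :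
    (doubleMetric I F V).fn a b = (1 / 2 : ℝ) • doubleForm a b := rfl

/-- The bracket on `Γ(V ⊕ V*)` and the Dorfman bracket differ by `𝒟(e₁, e₂)₊`. -/
theorem dorfman_eq (L : LieAlgebroid I F V) (L' : LieAlgebroid I (F →L[ℝ] ℝ) (Dual V))
    (a b : Sec I (F × (F →L[ℝ] ℝ)) (V ×ᵇ Dual V)) :
    dorfman L L' a b
      = doubleBracket L L' a b + doubleD L L' ((doubleMetric I F V).fn a b) :=
  eq_of_doubleForm fun c => by
    rw [doubleForm_add, doubleForm_doubleD, doubleForm_dorfman, doubleAnchor_act, doubleMetric_fn]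
    simp only [doubleForm, doubleBracket, pairingMinus, fst_pair, snd_pair, pairing_add,
      pairing_sub, pairing_add_left, pairing_sub_left, L.pairing_lieDeriv, L.pairing_d₀,
      L'.pairing_lieDerivStar, L'.pairing_dStar₀, Anchor.act_real_smul, Anchor.act_sub,
      Anchor.act_add]
    module

theorem doubleMetric_doubleD (L : LieAlgebroid I F V) (L' : LieAlgebroid I (F →L[ℝ] ℝ) (Dual V))
    (f : Fn I P) (a : Sec I (F × (F →L[ℝ] ℝ)) (V ×ᵇ Dual V)) :
    (doubleMetric I F V).fn (doubleD L L' f) a = (1 / 2 : ℝ) • (doubleAnchor L L').act a f := by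
  rw [doubleMetric_fn, doubleForm_doubleD]

theorem doubleBracket_eq (L : LieAlgebroid I F V) (L' : LieAlgebroid I (F →L[ℝ] ℝ) (Dual V))
    (a b : Sec I (F × (F →L[ℝ] ℝ)) (V ×ᵇ Dual V)) :
    doubleBracket L L' a b
      = dorfman L L' a b - doubleD L L' ((doubleMetric I F V).fn a b) :=
  eq_sub_of_add_eq (dorfman_eq L L' a b).symm

/-! ### Multiplication by constants and by functions -/

theorem pairing_real_smul (ξ : Sec I (F →L[ℝ] ℝ) (Dual V)) (r : ℝ) (X : Sec I F V) :
    pairing ξ (r • X) = r • pairing ξ X := by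
  ext x; exact (ξ x).map_smul r (X x)

theorem pairing_real_smul_left (r : ℝ) (ξ : Sec I (F →L[ℝ] ℝ) (Dual V)) (X : Sec I F V) :
    pairing (r • ξ) X = r • pairing ξ X := rfl

theorem act_real_smul_left (a : Anchor I F V) (r : ℝ) (X : Sec I F V) (f : Fn I P) :
    a.act (r • X) f = r • a.act X f := by
  ext x
  change mfderiv I 𝓘(ℝ, ℝ) f x (a.toFun x (r • X x)) = _
  rw [map_smul, map_smul]
  rfl

theorem fst_real_smul (r : ℝ) (a : Sec I (F × (F →L[ℝ] ℝ)) (V ×ᵇ Dual V)) :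
    fst (r • a) = r • fst a := rfl

theorem snd_real_smul (r : ℝ) (a : Sec I (F × (F →L[ℝ] ℝ)) (V ×ᵇ Dual V)) :
    snd (r • a) = r • snd a := rfl

theorem fst_smul (f : Fn I P) (a : Sec I (F × (F →L[ℝ] ℝ)) (V ×ᵇ Dual V)) :
    fst (f • a) = f • fst a := rfl

theorem snd_smul (f : Fn I P) (a : Sec I (F × (F →L[ℝ] ℝ)) (V ×ᵇ Dual V)) :
    snd (f • a) = f • snd a := rfl

theorem doubleForm_real_smul (r : ℝ) (a b : Sec I (F × (F →L[ℝ] ℝ)) (V ×ᵇ Dual V)) :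
    doubleForm (r • a) b = r • doubleForm a b := by
  simp only [doubleForm, fst_real_smul, snd_real_smul, pairing_real_smul, pairing_real_smul_left,
    smul_add]

theorem doubleForm_smul (f : Fn I P) (a b : Sec I (F × (F →L[ℝ] ℝ)) (V ×ᵇ Dual V)) :
    doubleForm (f • a) b = f * doubleForm a b := by
  simp only [doubleForm, fst_smul, snd_smul, pairing_smul, pairing_smul_left, mul_add]

theorem doubleD_real_smul (L : LieAlgebroid I F V) (L' : LieAlgebroid I (F →L[ℝ] ℝ) (Dual V))
    (r : ℝ) (f : Fn I P) : doubleD L L' (r • f) = r • doubleD L L' f :=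
  eq_of_doubleForm fun e => by
    rw [doubleForm_real_smul, doubleForm_doubleD, doubleForm_doubleD, Anchor.act_real_smul]

theorem doubleD_mul (L : LieAlgebroid I F V) (L' : LieAlgebroid I (F →L[ℝ] ℝ) (Dual V))
    (f g : Fn I P) : doubleD L L' (f * g) = f • doubleD L L' g + g • doubleD L L' f :=
  eq_of_doubleForm fun e => by
    rw [doubleForm_add, doubleForm_smul, doubleForm_smul, doubleForm_doubleD, doubleForm_doubleD,
      doubleForm_doubleD, Anchor.act_mul, mul_comm g]

theorem dorfman_real_smul (L : LieAlgebroid I F V) (L' : LieAlgebroid I (F →L[ℝ] ℝ) (Dual V))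
    (r : ℝ) (a b : Sec I (F × (F →L[ℝ] ℝ)) (V ×ᵇ Dual V)) :
    dorfman L L' (r • a) b = r • dorfman L L' a b :=
  eq_of_doubleForm fun c => by
    simp only [doubleForm_real_smul, doubleForm_dorfman, fst_real_smul, snd_real_smul,
      pairing_real_smul, pairing_real_smul_left, L.smul_bracket, L'.smul_bracket,
      Anchor.act_real_smul, act_real_smul_left]
    module

theorem dorfman_smul (L : LieAlgebroid I F V) (L' : LieAlgebroid I (F →L[ℝ] ℝ) (Dual V))
    (a : Sec I (F × (F →L[ℝ] ℝ)) (V ×ᵇ Dual V)) (f : Fn I P)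
    (b : Sec I (F × (F →L[ℝ] ℝ)) (V ×ᵇ Dual V)) :
    dorfman L L' a (f • b) = f • dorfman L L' a b + (doubleAnchor L L').act a f • b :=
  eq_of_doubleForm fun c => by
    rw [doubleForm_add, doubleForm_smul, doubleForm_smul, doubleForm_dorfman, doubleForm_dorfman,
      doubleAnchor_act, doubleForm]
    simp only [fst_smul, snd_smul, pairing_smul, pairing_smul_left, L.leibniz, L'.leibniz,
      L.leibniz_left, L'.leibniz_left, pairing_add, pairing_sub, pairing_add_left,
      pairing_sub_left, Anchor.act_mul, Anchor.act_smul_left]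
    ring

/-! ### The double of a Lie bialgebroid -/

namespace IsLieBialgebroid

variable {L : LieAlgebroid I F V} {L' : LieAlgebroid I (F →L[ℝ] ℝ) (Dual V)}

theorem doubleBracket_skew (h : IsLieBialgebroid L L')
    (a b : Sec I (F × (F →L[ℝ] ℝ)) (V ×ᵇ Dual V)) :
    doubleBracket L L' a b = -doubleBracket L L' b a := by
  rw [eq_neg_iff_add_eq_zero, doubleBracket_eq, doubleBracket_eq, sub_add_sub_comm,
    h.isPreDorfman.dorf_symm, sub_eq_zero, ← h.isPreDorfman.D_add, doubleMetric_fn,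
    doubleMetric_fn, doubleForm_comm b]
  congr 1
  module

theorem doubleBracket_jacobi (h : IsLieBialgebroid L L')
    (a b c : Sec I (F × (F →L[ℝ] ℝ)) (V ×ᵇ Dual V)) :
    doubleBracket L L' (doubleBracket L L' a b) c + doubleBracket L L' (doubleBracket L L' b c) a
        + doubleBracket L L' (doubleBracket L L' c a) b
      = doubleD L L' ((1 / 3 : ℝ) • ((doubleMetric I F V).fn (doubleBracket L L' a b) c
          + (doubleMetric I F V).fn (doubleBracket L L' b c) a
          + (doubleMetric I F V).fn (doubleBracket L L' c a) b)) := by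
  have hD := h.isPreDorfman
  have e1 : ∀ a b c : Sec I (F × (F →L[ℝ] ℝ)) (V ×ᵇ Dual V),
      doubleBracket L L' (doubleBracket L L' a b) c = dorfman L L' (dorfman L L' a b) c
        - doubleD L L' ((doubleMetric I F V).fn (doubleBracket L L' a b) c) := by
    intro a b c
    rw [doubleBracket_eq _ _ (doubleBracket L L' a b), dorfman_eq L L' a b, hD.dorf_add_left,
      hD.D_dorf, add_zero]
  have e2 : ∀ a b c : Sec I (F × (F →L[ℝ] ℝ)) (V ×ᵇ Dual V), doubleForm a (dorfman L L' b c)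
      = (2 : ℝ) • (doubleMetric I F V).fn (doubleBracket L L' b c) a
        + (1 / 2 : ℝ) • (doubleAnchor L L').act a (doubleForm b c) := by
    intro a b c
    rw [dorfman_eq, doubleForm_comm, doubleForm_add, doubleForm_doubleD, doubleMetric_fn,
      doubleMetric_fn, Anchor.act_real_smul]
    module
  have e3 : ∀ a b c : Sec I (F × (F →L[ℝ] ℝ)) (V ×ᵇ Dual V),
      (doubleMetric I F V).fn (doubleBracket L L' a c) b
        = -(doubleMetric I F V).fn (doubleBracket L L' c a) b := by
    intro a b c
    rw [doubleMetric_fn, doubleMetric_fn, h.doubleBracket_skew, hD.form_neg_left, smul_neg]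
  -- the argument of `𝒟` in `three_nsmul_cyclic_sum` is `12 T`, as the terms `ρ(e) ( , )₊` cancel
  have key := hD.three_nsmul_cyclic_sum h.leibnizator_dorfman a b c
  have e4 : doubleForm a (dorfman L L' b c) - doubleForm b (dorfman L L' a c)
        + (doubleForm b (dorfman L L' c a) - doubleForm c (dorfman L L' b a))
        + (doubleForm c (dorfman L L' a b) - doubleForm a (dorfman L L' c b))
      = (4 : ℝ) • ((doubleMetric I F V).fn (doubleBracket L L' a b) c
          + (doubleMetric I F V).fn (doubleBracket L L' b c) a
          + (doubleMetric I F V).fn (doubleBracket L L' c a) b) := by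
    simp only [e2]
    rw [e3 a b c, e3 b c a, e3 c a b, doubleForm_comm c a, doubleForm_comm c b,
      doubleForm_comm b a]
    module
  rw [e4, doubleD_real_smul] at key
  rw [e1, e1, e1, doubleD_real_smul]
  rw [hD.D_add, hD.D_add] at key ⊢
  linear_combination (norm := module) (1 / 3 : ℝ) • key

/-- The Courant algebroid `V ⊕ V*` of a Lie bialgebroid. -/
def courantAlgebroid (h : IsLieBialgebroid L L') :
    CourantAlgebroid I (F × (F →L[ℝ] ℝ)) (V ×ᵇ Dual V) where
  metric := doubleMetric I F V
  bracket := doubleBracket L L'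
  anchor := doubleAnchor L L'
  D := doubleD L L'
  add_bracket a b c := by
    simp only [doubleBracket_eq, doubleMetric_fn, doubleD_real_smul, doubleForm_add,
      h.isPreDorfman.dorf_add_left, h.isPreDorfman.D_add]
    module
  smul_bracket r a b := by
    simp only [doubleBracket_eq, doubleMetric_fn, doubleD_real_smul, doubleForm_real_smul,
      dorfman_real_smul]
    module
  skew := h.doubleBracket_skew
  metric_D := doubleMetric_doubleD L L'
  jacobi := h.doubleBracket_jacobi
  anchor_bracket a b x := by
    rw [← sub_eq_zero]
    refine tangentVector_eq_zero x _ fun f => ?_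
    have h1 : (doubleAnchor L L').act (doubleBracket L L' a b) f
        = deriv (vectorFieldBracket ((doubleAnchor L L').map a) ((doubleAnchor L L').map b)) f := by
      rw [doubleBracket_eq, act_sub_left, h.isPreDorfman.act_D, sub_zero, h.isPreDorfman.act_dorf,
        deriv_vectorFieldBracket]
      rfl
    rw [map_sub, sub_eq_zero]
    exact congrArg (fun g : Fn I P => g x) h1
  leibniz a f b := by
    have h1 : (doubleMetric I F V).fn a (f • b) = f * (doubleMetric I F V).fn a b := by
      rw [doubleMetric_fn, doubleMetric_fn, doubleForm_comm, doubleForm_smul, doubleForm_comm,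
        mul_smul_comm]
    rw [doubleBracket_eq, doubleBracket_eq, h1, doubleD_mul, dorfman_smul, smul_sub]
    abel
  anchor_D f := by
    ext x
    exact tangentVector_eq_zero x _ fun g =>
      congrArg (fun k : Fn I P => k x) (h.isPreDorfman.act_D f g)
  metric_D_D f g := by
    rw [doubleMetric_doubleD, h.isPreDorfman.act_D, smul_zero]
  act_metric a b c := by
    rw [← dorfman_eq, ← dorfman_eq]
    simp only [doubleMetric_fn, Anchor.act_real_smul, h.isPreDorfman.act_form, smul_add]

end IsLieBialgebroid

end Geometry

end Algebroid

end

theorem theorem2p5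
    {EP : Type*} [NormedAddCommGroup EP] [NormedSpace ℝ EP] [FiniteDimensional ℝ EP]
    {HP : Type*} [TopologicalSpace HP] {I : ModelWithCorners ℝ EP HP}
    {P : Type*} [TopologicalSpace P] [ChartedSpace HP P] [IsManifold I ∞ P]
    [BoundarylessManifold I P] [T2Space P]
    {F : Type*} [NormedAddCommGroup F] [NormedSpace ℝ F] [FiniteDimensional ℝ F]
    {A : P → Type*} [∀ x, AddCommGroup (A x)] [∀ x, Module ℝ (A x)]
    [∀ x, TopologicalSpace (A x)] [∀ x, IsTopologicalAddGroup (A x)]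
    [∀ x, ContinuousSMul ℝ (A x)] [TopologicalSpace (TotalSpace F A)]
    [FiberBundle F A] [VectorBundle ℝ F A] [ContMDiffVectorBundle ∞ F A I]
    (L : Algebroid.LieAlgebroid I F A)
    (L' : Algebroid.LieAlgebroid I (F →L[ℝ] ℝ) (Algebroid.Dual A))
    (h : Algebroid.IsLieBialgebroid L L') :
    ∃ C : Algebroid.CourantAlgebroid I (F × (F →L[ℝ] ℝ)) (A ×ᵇ Algebroid.Dual A),
      (∀ x, C.metric.form x = Algebroid.pairingPlus x) ∧
      C.bracket = Algebroid.doubleBracket L L' ∧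
      C.anchor = Algebroid.doubleAnchor L L' :=
  ⟨h.courantAlgebroid, fun _ => rfl, rfl, rfl⟩
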